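/- **Setting.** Let $\Theta=[0,1]$, $Q=[0,\overline q]$ with $\overline q>0$. Let $F$ be a continuous distribution function whose law has support $\Theta$, with $F\in C^2(\Theta)$ and $F'>0$ on $[0,1)$. Let $u(q,\theta)=g(q)+\theta q$, where $g\colon Q\to\mathbb R$ is $C^2$, strictly increasing and strictly concave, and let $c\colon Q\to\mathbb R$ be strictly increasing, strictly convex and differentiable. Let $J(q,\theta)=u(q,\theta)-\frac{1-F(\theta)}{F'(\theta)}\,q$ be the virtual surplus; it is assumed to be $C^2$ on $Q\times\Theta$, and its partial derivative $J_1=\partial J/\partial q$ is assumed to satisfy $$\lim_{q\to0}\Big(\int_\Theta J_1(q,\theta)\,dF(\theta)-c'(q)\Big)>0>\lim_{q\to\overline q}\Big(\int_\Theta J_1(q,\theta)\,dF(\theta)-c'(q)\Big).$$ The virtual value $\theta-\frac{1-F(\theta)}{F'(\theta)}$ is not assumed to be monotone. An *allocation* is a measurable $\boldsymbol q\colon\Theta\to Q$. A *mechanism* is a pair of an allocation $\boldsymbol q$ and a function $t\colon\Theta\to\mathbb R$ with $u(\boldsymbol q(\theta),\theta)-t(\theta)\ge u(\boldsymbol q(\theta'),\theta)-t(\theta')$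 and $u(\boldsymbol q(\theta),\theta)-t(\theta)\ge0$ for all $\theta,\theta'\in\Theta$. The allocation $\boldsymbol q$ is *monopolist* if, for some $t$, the pair $(\boldsymbol q,t)$ maximizes $\int_\Theta t\,dF-c(\sup\boldsymbol q)$ over all mechanisms. For $q\in Q$, let $V(q)$ be the supremum of $\int_\Theta t\,dF$ over mechanisms with $\boldsymbol q\le q$ on $\Theta$, and let $U(q)$ be the supremum of $\int_\Theta u(\boldsymbol q(\theta),\theta)\,dF(\theta)$ over allocations with $\boldsymbol q\le q$ on $\Theta$. *Ironing.* For $q\in Q$ and $x\in[0,1]$ let $H(q,x)=\int_0^x J_1(q,F^{-1}(s))\,ds$, let $\operatorname{conv}H(q,\cdot)$ be its lower convex envelope on $[0,1]$, and let $h(q,\cdot)$ be the right derivative of $\operatorname{conv}H(q,\cdot)$ (the left derivative at $x=1$). The ironed virtual surplus is $\overline J(q,\theta)=J(0,\theta)+\int_0^q h(\tilde q,F(\theta))\,d\tilde q$, with $\overline J_1=\partial\overline J/\partial q$; $\overline{\boldsymbol\beta}(\theta)$ is the largest maximizer of $\overline J(\cdot,\theta)$ over $Q$; and $T^-(q)=\inf\{\theta\in\Theta:\overline{\boldsymbol\beta}(\theta)\ge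 q\}$, with $\inf\emptyset=1$. **Proposition.** 1. $V$ is concave on $Q$, and for every $q\in(0,\overline q]$ its left derivative at $q$ exists and equals $\int_{[T^-(q),1]}\overline J_1(q,\theta)\,dF(\theta)$. 2. $V-c$ has a unique maximizer $q^M$ over $Q$, and $U-c$ has a unique maximizer $q^\star$ over $Q$. 3. An allocation $\boldsymbol q$ is monopolist if and only if there is a nondecreasing allocation $\boldsymbol\gamma$ with $\boldsymbol\gamma=\overline{\boldsymbol\beta}$ almost everywhere and $\boldsymbol q(\theta)=\min\{\boldsymbol\gamma(\theta),q^M\}$ for all $\theta\in\Theta$. 4. If moreover $\lim_{q\to\overline q}\big(\int_\Theta u_1(q,\theta)\,dF(\theta)-c'(q)\big)<0$, where $u_1=\partial u/\partial q$ (so that $q^\star$ lies below the artificial bound $\overline q$), then $q^M<q^\star$. -/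

import Mathlib

open Set Filter Topology MeasureTheory

noncomputable section

namespace DigitalGoods

/-- The data of the screening problem: the largest quality `qbar`, the law `μ` of the buyer's type,
the quality component `g` of the utility `u(q, θ) = g(q) + θ q`, and the cost `c` of the largest
quality that is produced. -/
structure Primitives where
  qbar : ℝ
  μ : Measure ℝ
  g : ℝ → ℝ
  c : ℝ → ℝ

/-- The type space `Θ = [0, 1]`. -/
def Theta : Set ℝ := Icc 0 1

namespace Primitives

variable (P : Primitives)

/-- The set of qualities `[0, qbar]`. -/
def Q : Set ℝ := Icc 0 P.qbar

/-- The distribution function of the type. -/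
def F (θ : ℝ) : ℝ := ProbabilityTheory.cdf P.μ θ

/-- The density `F'` (one-sided derivatives at the endpoints of `Θ`). -/
def F' (θ : ℝ) : ℝ := derivWithin P.F Theta θ

/-- The utility of type `θ` from quality `q`. -/
def u (q θ : ℝ) : ℝ := P.g q + θ * q

/-- The marginal utility `∂u/∂q`. -/
def u1 (q θ : ℝ) : ℝ := derivWithin (fun x => P.u x θ) P.Q q

/-- The virtual surplus `J(q, θ) = u(q, θ) - (1 - F(θ)) / F'(θ) * ∂u/∂θ(q, θ)`,
where `∂u/∂θ(q, θ) = q`. -/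
def J (q θ : ℝ) : ℝ := P.u q θ - (1 - P.F θ) / P.F' θ * q

/-- The marginal virtual surplus `∂J/∂q`. -/
def J1 (q θ : ℝ) : ℝ := derivWithin (fun x => P.J x θ) P.Q q

/-- The marginal cost `c'`. -/
def c' (q : ℝ) : ℝ := derivWithin P.c P.Q q

/-- The standing assumptions. The virtual value is not assumed to be monotone. -/
structure Assumptions : Prop where
  qbar_pos : 0 < P.qbar
  prob : IsProbabilityMeasure P.μ
  support_eq : P.μ.support = Theta
  F_continuous : Continuous P.F
  F_contDiffOn : ContDiffOn ℝ 2 P.F Theta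
  F'_pos : ∀ θ ∈ Ico (0 : ℝ) 1, 0 < P.F' θ
  J_contDiffOn : ContDiffOn ℝ 2 (fun x : ℝ × ℝ => P.J x.1 x.2) (P.Q ×ˢ Theta)
  g_contDiffOn : ContDiffOn ℝ 2 P.g P.Q
  g_strictMonoOn : StrictMonoOn P.g P.Q
  g_strictConcaveOn : StrictConcaveOn ℝ P.Q P.g
  c_strictMonoOn : StrictMonoOn P.c P.Q
  c_strictConvexOn : StrictConvexOn ℝ P.Q P.c
  c_differentiableOn : DifferentiableOn ℝ P.c P.Q
  boundary_zero : ∃ L > 0,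
    Tendsto (fun q => (∫ θ in Theta, P.J1 q θ ∂P.μ) - P.c' q) (𝓝[>] 0) (𝓝 L)
  boundary_qbar : ∃ L < 0,
    Tendsto (fun q => (∫ θ in Theta, P.J1 q θ ∂P.μ) - P.c' q) (𝓝[<] P.qbar) (𝓝 L)

/-! ### Allocations, mechanisms, and the two benchmark problems

Functions on `Θ` are represented by functions on `ℝ` of which only the values on `Θ` are used. -/

/-- An allocation is a measurable map from `Θ` to the set of qualities. -/
def IsAllocation (a : ℝ → ℝ) : Prop :=
  Measurable (Theta.domRestrict a) ∧ MapsTo a Theta P.Q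

/-- Incentive-compatible and individually rational direct mechanisms (allocation, transfer). -/
def IsMechanism (a t : ℝ → ℝ) : Prop :=
  P.IsAllocation a ∧
  (∀ θ ∈ Theta, ∀ θ' ∈ Theta, P.u (a θ') θ - t θ' ≤ P.u (a θ) θ - t θ) ∧
  (∀ θ ∈ Theta, 0 ≤ P.u (a θ) θ - t θ)

/-- The seller's revenue (the transfer in a mechanism is automatically `μ`-integrable). -/
def revenue (t : ℝ → ℝ) : ℝ := ∫ θ in Theta, t θ ∂P.μ

/-- The seller's profit, `∫ t dF - c(sup a)`. -/
def profit (a t : ℝ → ℝ) : ℝ := P.revenue t - P.c (sSup (a '' Theta))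

/-- `a` is the allocation of a profit-maximizing mechanism. -/
def IsMonopolist (a : ℝ → ℝ) : Prop :=
  ∃ t, P.IsMechanism a t ∧ ∀ a' t', P.IsMechanism a' t' → P.profit a' t' ≤ P.profit a t

/-- The largest revenue from mechanisms whose qualities are at most `q`. -/
def V (q : ℝ) : ℝ :=
  sSup {r | ∃ a t, P.IsMechanism a t ∧ (∀ θ ∈ Theta, a θ ≤ q) ∧ r = P.revenue t}

/-- The largest total utility from allocations whose qualities are at most `q`. -/
def U (q : ℝ) : ℝ :=
  sSup {r | ∃ a, P.IsAllocation a ∧ (∀ θ ∈ Theta, a θ ≤ q) ∧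
    r = ∫ θ in Theta, P.u (a θ) θ ∂P.μ}

/-- The set of maximizers of `f` over the set of qualities. -/
def argmaxQ (f : ℝ → ℝ) : Set ℝ := {q ∈ P.Q | ∀ q' ∈ P.Q, f q' ≤ f q}

/-! ### Ironing -/

/-- The quantile function `F⁻¹` on `[0, 1]`. -/
def quantile (s : ℝ) : ℝ := sInf {θ ∈ Theta | s ≤ P.F θ}

/-- The cumulative marginal virtual surplus, in quantile space. -/
def H (q x : ℝ) : ℝ := ∫ s in (0 : ℝ)..x, P.J1 q (P.quantile s)

/-- The lower convex envelope of `H(q, ·)` on `[0, 1]`. -/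
def convH (q x : ℝ) : ℝ :=
  sInf {y | ∃ x₁ ∈ Icc (0 : ℝ) 1, ∃ x₂ ∈ Icc (0 : ℝ) 1, ∃ l ∈ Icc (0 : ℝ) 1,
    l * x₁ + (1 - l) * x₂ = x ∧ y = l * P.H q x₁ + (1 - l) * P.H q x₂}

/-- The right derivative of the convex envelope in the quantile `x ∈ [0, 1)`;
at `x = 1`, where there is no right derivative, the left one. -/
def slope (q x : ℝ) : ℝ :=
  if x < 1 then derivWithin (P.convH q) (Ioi x) x else derivWithin (P.convH q) (Iio x) x

/-- The ironed virtual surplus. -/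
def Jbar (q θ : ℝ) : ℝ := P.J 0 θ + ∫ x in (0 : ℝ)..q, P.slope x (P.F θ)

/-- The marginal ironed virtual surplus `∂Jbar/∂q`. -/
def Jbar1 (q θ : ℝ) : ℝ := derivWithin (fun x => P.Jbar x θ) P.Q q

/-- The ironed virtual surplus maximizer (the largest one). -/
def betaBar (θ : ℝ) : ℝ := sSup (P.argmaxQ fun q => P.Jbar q θ)

/-- The left-continuous inverse of the ironed virtual surplus maximizer,
`inf {θ ∈ Θ | betaBar θ ≥ q}`; adjoining `1 = max Θ` makes the infimum of the empty set `1`. -/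
def Tminus (q : ℝ) : ℝ := sInf ({θ ∈ Theta | q ≤ P.betaBar θ} ∪ {1})

end Primitives

end DigitalGoods

end

open Set Filter Topology MeasureTheory

noncomputable section

namespace DigitalGoods

/-! ### Functions with a monotone subgradient -/

/-! Since `u` is linear in the type, the marginal virtual surplus splits as `g'(q) + φ(θ)` with `φ`
the virtual value, so `H(q, ·)` is a linear function plus a curve `R(x) = -F⁻¹(x)(1 - x)` that does
not involve `q`. Ironing therefore means convexifying one curve: with `φbar` the slope of `conv R`
at `F(θ)`, the ironed surplus is `g(q) + φbar(θ) q`, strictly concave in `q`, and its maximizer is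
unique and nondecreasing in `θ`.

Incentive compatibility says that the rent has the allocation `a` as a subgradient. Hence `a` is
nondecreasing and the revenue is the expected virtual surplus minus the rent of type 0
(`revenue_eq`). Replacing `φ` by `φbar` changes the integral by `∫ (φ - φbar) a dF`. Slicing `a`
into its upper level sets `[τ, 1]`, each slice contributes `conv R - R` at `F(τ)`: never positive,
and zero if `a` increases only where `φbar` does, because the envelope touches the curve there
(`integral_gap_mul_nonpos`, `integral_gap_mul_eq_zero`). Pointwise maximization under a cap `q`
gives `min(βbar, q)`, which has zero gap, so `V(q)` is the integral of its ironed surplus, and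
optimal mechanisms agree with it almost everywhere (`V_eq`, `ae_eq_capped`).

The capped maximum has supergradient `max(g'(q) + φbar, 0)` in the cap. Its mean is continuous in
`q`, so it is the derivative of the concave function `V`; the positive part is supported on `βbar ≥
q`, which yields the formula with `T⁻`. Strict convexity of `c` gives uniqueness, and a mechanism
earns at most `V - c` at the supremum of its allocation, so monopolists are the capped maximizers at
`q^M`.

On the efficient side `U(q) = g(q) + E[θ] q`. The marginal revenue is at most `g'(q) + max θ(1 -
F(θ))`, and a strict Markov inequality puts this below `g'(q) + E[θ]` (`marginalValue_lt`). Thus `U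
- V` is strictly increasing, and the first-order conditions exclude equality of the two maximizers.
-/

lemma abs_sub_sub_le_of_subgradient {S : Set ℝ} {r a f : ℝ → ℝ}
    (h : ∀ x ∈ S, ∀ y ∈ S, r x + a x * (f y - f x) ≤ r y) {x y : ℝ} (hx : x ∈ S) (hy : y ∈ S) :
    |r y - r x - a x * (f y - f x)| ≤ |a y - a x| * |f y - f x| := by
  have h1 := h x hx y hy
  have h2 := h y hy x hx
  rw [abs_of_nonneg (by linarith), ← abs_mul]
  exact le_trans (by linarith) (le_abs_self _)

/-- The two subgradient inequalities at `x` and `y` squeeze the error of the linearization to `|a y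
- a x| |f y - f x|`, which is `o(1) O(y - x)` once `a` is continuous at `x`. The lemma serves three
times: for rents, for the ironed revenue curve and for `-V`. -/
lemma hasDerivWithinAt_of_subgradient {S : Set ℝ} {r a f : ℝ → ℝ} {x f' : ℝ}
    (h : ∀ x ∈ S, ∀ y ∈ S, r x + a x * (f y - f x) ≤ r y) (hx : x ∈ S)
    (hf : HasDerivWithinAt f f' S x) (ha : ContinuousWithinAt a S x) :
    HasDerivWithinAt r (a x * f') S x := by
  have hO : (fun y => f y - f x) =O[𝓝[S] x] fun y => y - x :=
    hf.isBigO_sub.comp_tendsto (tendsto_id.prodMk tendsto_const_pure)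
  have ho : (fun y => a y - a x) =o[𝓝[S] x] fun _ => (1 : ℝ) := by
    rw [Asymptotics.isLittleO_one_iff]
    have := (show Tendsto a (𝓝[S] x) (𝓝 (a x)) from ha).sub_const (a x)
    simpa using this
  have h1 : (fun y => r y - r x - a x * (f y - f x)) =o[𝓝[S] x] fun y => y - x := by
    have h2 : (fun y => (a y - a x) * (f y - f x)) =o[𝓝[S] x] fun y => (1 : ℝ) * (y - x) :=
      ho.mul_isBigO hO
    simp only [one_mul] at h2
    refine Asymptotics.IsBigO.trans_isLittleO ?_ h2
    refine Asymptotics.IsBigO.of_bound 1 ?_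
    filter_upwards [self_mem_nhdsWithin] with y hy
    rw [Real.norm_eq_abs, Real.norm_eq_abs, abs_mul, one_mul]
    exact abs_sub_sub_le_of_subgradient h hx hy
  have h3 := (hasDerivWithinAt_iff_isLittleO.1 hf).const_mul_left (a x)
  rw [hasDerivWithinAt_iff_isLittleO]
  refine (h1.add h3).congr_left fun y => ?_
  simp only [smul_eq_mul]
  ring

lemma continuousOn_of_subgradient {r a f : ℝ → ℝ} {p q : ℝ}
    (h : ∀ x ∈ Icc p q, ∀ y ∈ Icc p q, r x + a x * (f y - f x) ≤ r y)
    (ha : MonotoneOn a (Icc p q)) (hf : ContinuousOn f (Icc p q)) :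
    ContinuousOn r (Icc p q) := by
  intro x hx
  have hpq : p ≤ q := hx.1.trans hx.2
  set M := |a p| + |a q|
  have hM : ∀ y ∈ Icc p q, |a y| ≤ M := by
    intro y hy
    have h1 := ha ⟨le_rfl, hpq⟩ hy hy.1
    have h2 := ha hy ⟨hpq, le_rfl⟩ hy.2
    rw [abs_le]
    constructor
    · linarith [neg_abs_le (a p), abs_nonneg (a q)]
    · linarith [le_abs_self (a q), abs_nonneg (a p)]
  have hfx : Tendsto (fun y => M * |f y - f x|) (𝓝[Icc p q] x) (𝓝 0) := by
    have := (((show Tendsto f _ (𝓝 (f x)) from hf x hx).sub_const (f x)).abs).const_mul M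
    simpa using this
  refine tendsto_iff_norm_sub_tendsto_zero.2 ?_
  refine squeeze_zero' (Eventually.of_forall fun _ => norm_nonneg _) ?_ hfx
  filter_upwards [self_mem_nhdsWithin] with y hy
  have h1 := h x hx y hy
  have h2 := h y hy x hx
  have e1 : |a x * (f y - f x)| ≤ M * |f y - f x| := by
    rw [abs_mul]; exact mul_le_mul_of_nonneg_right (hM x hx) (abs_nonneg _)
  have e2 : |a y * (f y - f x)| ≤ M * |f y - f x| := by
    rw [abs_mul]; exact mul_le_mul_of_nonneg_right (hM y hy) (abs_nonneg _)
  rw [Real.norm_eq_abs, abs_le]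
  rw [abs_le] at e1 e2
  constructor <;> linarith [e1.1, e2.2]

lemma countable_not_continuousAt_Ioo {a : ℝ → ℝ} {p q : ℝ} (ha : MonotoneOn a (Icc p q)) :
    {x | x ∈ Ioo p q ∧ ¬ ContinuousAt a x}.Countable := by
  refine ha.countable_not_continuousWithinAt.mono ?_
  rintro x ⟨hx, hc⟩
  exact ⟨Ioo_subset_Icc_self hx, fun h => hc (h.continuousAt (Icc_mem_nhds hx.1 hx.2))⟩

lemma intervalIntegrable_monotoneOn_mul {a f' : ℝ → ℝ} {p q : ℝ} (hpq : p ≤ q)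
    (ha : MonotoneOn a (Icc p q)) (hf' : ContinuousOn f' (Icc p q)) :
    IntervalIntegrable (fun x => a x * f' x) volume p q := by
  rw [← uIcc_of_le hpq] at ha hf'
  exact ha.intervalIntegrable.mul_continuousOn hf'

/-- A monotone `a` has only countably many discontinuities, and the fundamental theorem of calculus
tolerates a countable exceptional set as long as `r` is continuous. -/
lemma integral_of_subgradient {r a f f' : ℝ → ℝ} {p q : ℝ} (hpq : p ≤ q)
    (h : ∀ x ∈ Icc p q, ∀ y ∈ Icc p q, r x + a x * (f y - f x) ≤ r y)
    (ha : MonotoneOn a (Icc p q))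
    (hf : ∀ x ∈ Icc p q, HasDerivWithinAt f (f' x) (Icc p q) x)
    (hf' : ContinuousOn f' (Icc p q)) :
    ∫ x in p..q, a x * f' x = r q - r p := by
  refine integral_eq_of_hasDerivAt_off_countable_of_le r _ hpq
    (countable_not_continuousAt_Ioo ha)
    (continuousOn_of_subgradient h ha fun x hx => (hf x hx).continuousWithinAt) ?_
    (intervalIntegrable_monotoneOn_mul hpq ha hf')
  rintro x ⟨hx, hc⟩
  have hc' : ContinuousAt a x := by
    by_contra hcc
    exact hc ⟨hx, hcc⟩
  have hx' := Ioo_subset_Icc_self hx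
  exact (hasDerivWithinAt_of_subgradient h hx' (hf x hx') hc'.continuousWithinAt).hasDerivAt
    (Icc_mem_nhds hx.1 hx.2)

/-! ### The lower convex envelope of a function on the unit interval -/

/-- The lower convex envelope on `[0, 1]`, as the infimum of the chords of the graph. -/
def chordEnvelope (f : ℝ → ℝ) (x : ℝ) : ℝ :=
  sInf {y | ∃ x₁ ∈ Icc (0 : ℝ) 1, ∃ x₂ ∈ Icc (0 : ℝ) 1, ∃ l ∈ Icc (0 : ℝ) 1,
    l * x₁ + (1 - l) * x₂ = x ∧ y = l * f x₁ + (1 - l) * f x₂}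

/-- The right derivative on `[0, 1)`, the left derivative from `1` on. -/
def oneSidedSlope (f : ℝ → ℝ) (x : ℝ) : ℝ :=
  if x < 1 then derivWithin f (Ioi x) x else derivWithin f (Iio x) x

lemma le_of_mem_chords {f : ℝ → ℝ} {m z x y : ℝ} (h : ∀ x ∈ Icc (0 : ℝ) 1, m + z * x ≤ f x)
    (hy : ∃ x₁ ∈ Icc (0 : ℝ) 1, ∃ x₂ ∈ Icc (0 : ℝ) 1, ∃ l ∈ Icc (0 : ℝ) 1,
      l * x₁ + (1 - l) * x₂ = x ∧ y = l * f x₁ + (1 - l) * f x₂) : m + z * x ≤ y := by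
  obtain ⟨x₁, h₁, x₂, h₂, l, hl, rfl, rfl⟩ := hy
  have e1 := mul_le_mul_of_nonneg_left (h x₁ h₁) hl.1
  have e2 := mul_le_mul_of_nonneg_left (h x₂ h₂) (sub_nonneg.2 hl.2)
  linarith

lemma le_chordEnvelope {f : ℝ → ℝ} {m z x : ℝ} (h : ∀ x ∈ Icc (0 : ℝ) 1, m + z * x ≤ f x)
    (hx : x ∈ Icc (0 : ℝ) 1) : m + z * x ≤ chordEnvelope f x :=
  le_csInf ⟨_, x, hx, x, hx, 0, by simp, by ring, rfl⟩ fun _ hy => le_of_mem_chords h hy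

lemma chordEnvelope_le_chord {f : ℝ → ℝ} {m : ℝ} (h : ∀ x ∈ Icc (0 : ℝ) 1, m ≤ f x)
    {x₁ x₂ l : ℝ} (h₁ : x₁ ∈ Icc (0 : ℝ) 1) (h₂ : x₂ ∈ Icc (0 : ℝ) 1) (hl : l ∈ Icc (0 : ℝ) 1) :
    chordEnvelope f (l * x₁ + (1 - l) * x₂) ≤ l * f x₁ + (1 - l) * f x₂ :=
  csInf_le ⟨m, fun y hy => by
    simpa using le_of_mem_chords (m := m) (z := 0) (fun x hx => by simpa using h x hx) hy⟩
    ⟨x₁, h₁, x₂, h₂, l, hl, rfl, rfl⟩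

lemma chordEnvelope_le {f : ℝ → ℝ} {m : ℝ} (h : ∀ x ∈ Icc (0 : ℝ) 1, m ≤ f x)
    {x : ℝ} (hx : x ∈ Icc (0 : ℝ) 1) : chordEnvelope f x ≤ f x := by
  simpa using chordEnvelope_le_chord h hx hx (l := 0) (by simp)

lemma chordEnvelope_congr {f f' : ℝ → ℝ} (h : ∀ x ∈ Icc (0 : ℝ) 1, f x = f' x) (x : ℝ) :
    chordEnvelope f x = chordEnvelope f' x := by
  unfold chordEnvelope
  congr 1
  ext y
  constructor
  · rintro ⟨x₁, h₁, x₂, h₂, l, hl, e, e'⟩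
    exact ⟨x₁, h₁, x₂, h₂, l, hl, e, by rw [e', h _ h₁, h _ h₂]⟩
  · rintro ⟨x₁, h₁, x₂, h₂, l, hl, e, e'⟩
    exact ⟨x₁, h₁, x₂, h₂, l, hl, e, by rw [e', h _ h₁, h _ h₂]⟩

lemma chordEnvelope_add_linear {f : ℝ → ℝ} {m : ℝ} (h : ∀ x ∈ Icc (0 : ℝ) 1, m ≤ f x) (z : ℝ)
    {x : ℝ} (hx : x ∈ Icc (0 : ℝ) 1) :
    chordEnvelope (fun s => z * s + f s) x = z * x + chordEnvelope f x := by
  have hne : ∀ f : ℝ → ℝ, {y | ∃ x₁ ∈ Icc (0 : ℝ) 1, ∃ x₂ ∈ Icc (0 : ℝ) 1, ∃ l ∈ Icc (0 : ℝ) 1,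
    l * x₁ + (1 - l) * x₂ = x ∧ y = l * f x₁ + (1 - l) * f x₂}.Nonempty := fun f =>
    ⟨_, x, hx, x, hx, 0, by simp, by ring, rfl⟩
  have hm : ∀ s ∈ Icc (0 : ℝ) 1, m - |z| ≤ z * s + f s := by
    intro s hs
    have h1 : |z * s| ≤ |z| := by
      rw [abs_mul, abs_of_nonneg hs.1]; exact mul_le_of_le_one_right (abs_nonneg z) hs.2
    linarith [h s hs, neg_abs_le (z * s)]
  apply le_antisymm
  · rw [← sub_le_iff_le_add']
    refine le_csInf (hne f) ?_
    rintro y ⟨x₁, h₁, x₂, h₂, l, hl, rfl, rfl⟩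
    linarith [chordEnvelope_le_chord hm h₁ h₂ hl]
  · refine le_csInf (hne _) ?_
    rintro y ⟨x₁, h₁, x₂, h₂, l, hl, rfl, rfl⟩
    linarith [chordEnvelope_le_chord h h₁ h₂ hl]

/-- A function on `[0, 1]` that vanishes at both ends, with slopes there bounded by `L`. -/
structure Pinned (f : ℝ → ℝ) (L : ℝ) : Prop where
  zero : f 0 = 0
  one : f 1 = 0
  lower_left : ∀ x ∈ Icc (0 : ℝ) 1, -L * x ≤ f x
  lower_right : ∀ x ∈ Icc (0 : ℝ) 1, -L * (1 - x) ≤ f x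

namespace Pinned

variable {f : ℝ → ℝ} {L : ℝ}

lemma bound (hf : Pinned f L) : ∀ x ∈ Icc (0 : ℝ) 1, -|L| ≤ f x := by
  intro x hx
  refine le_trans ?_ (hf.lower_left x hx)
  have : L * x ≤ |L| := (mul_le_mul_of_nonneg_right (le_abs_self L) hx.1).trans
    (mul_le_of_le_one_right (abs_nonneg L) hx.2)
  linarith

lemma env_lower_left (hf : Pinned f L) {x : ℝ} (hx : x ∈ Icc (0 : ℝ) 1) :
    -L * x ≤ chordEnvelope f x := by
  simpa using le_chordEnvelope (m := 0) (z := -L) (fun x hx => by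
    simpa using hf.lower_left x hx) hx

lemma env_lower_right (hf : Pinned f L) {x : ℝ} (hx : x ∈ Icc (0 : ℝ) 1) :
    -L * (1 - x) ≤ chordEnvelope f x := by
  have := le_chordEnvelope (f := f) (m := -L) (z := L) (fun x hx => by
    linarith [hf.lower_right x hx]) hx
  linarith

lemma env_zero (hf : Pinned f L) : chordEnvelope f 0 = 0 := by
  apply le_antisymm
  · simpa [hf.zero] using chordEnvelope_le hf.bound (x := 0) (by simp)
  · simpa using hf.env_lower_left (x := 0) (by simp)

lemma env_one (hf : Pinned f L) : chordEnvelope f 1 = 0 := by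
  apply le_antisymm
  · simpa [hf.one] using chordEnvelope_le hf.bound (x := 1) (by simp)
  · simpa using hf.env_lower_right (x := 1) (by simp)

/-- A chord over `[p, q]` through the abscissa `x` lies above the envelope value there, so every
slope from the left of `(x, v)` to the graph is at most every slope to the right. The supremum of
the left slopes is a supporting slope. -/
lemma exists_support_Ioo (hf : Pinned f L) {x : ℝ} (hx : x ∈ Ioo (0 : ℝ) 1) :
    ∃ z, ∀ y ∈ Icc (0 : ℝ) 1, chordEnvelope f x + z * (y - x) ≤ f y := by
  set v := chordEnvelope f x with hv
  have key : ∀ p ∈ Ico 0 x, ∀ q ∈ Ioc x 1, (v - f p) / (x - p) ≤ (f q - v) / (q - x) := by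
    intro p hp q hq
    have hpx : 0 < x - p := sub_pos.2 hp.2
    have hxq : 0 < q - x := sub_pos.2 hq.1
    have hpq : 0 < q - p := by linarith
    rw [div_le_div_iff₀ hpx hxq]
    have hl : (q - x) / (q - p) ∈ Icc (0 : ℝ) 1 :=
      ⟨by positivity, by rw [div_le_one hpq]; linarith [hp.2]⟩
    have h1 := chordEnvelope_le_chord hf.bound (x₁ := p) (x₂ := q)
      ⟨hp.1, (hp.2.trans hx.2).le⟩ ⟨(hx.1.trans hq.1).le, hq.2⟩ hl
    have e : (q - x) / (q - p) * p + (1 - (q - x) / (q - p)) * q = x := by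
      field_simp; ring
    rw [e, ← hv] at h1
    have h2 := mul_le_mul_of_nonneg_right h1 hpq.le
    have e2 : ((q - x) / (q - p) * f p + (1 - (q - x) / (q - p)) * f q) * (q - p)
        = (q - x) * f p + (x - p) * f q := by
      field_simp; ring
    rw [e2] at h2
    linarith
  set T := (fun p => (v - f p) / (x - p)) '' Ico 0 x
  have hT : T.Nonempty := ⟨_, 0, ⟨le_rfl, hx.1⟩, rfl⟩
  have hTb : ∀ q ∈ Ioc x 1, ∀ t ∈ T, t ≤ (f q - v) / (q - x) := by
    rintro q hq _ ⟨p, hp, rfl⟩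
    exact key p hp q hq
  refine ⟨sSup T, fun y hy => ?_⟩
  rcases lt_trichotomy y x with hyx | rfl | hyx
  · have h1 : (v - f y) / (x - y) ≤ sSup T :=
      le_csSup ⟨_, hTb 1 ⟨hx.2, le_rfl⟩⟩ ⟨y, ⟨hy.1, hyx⟩, rfl⟩
    rw [div_le_iff₀ (sub_pos.2 hyx)] at h1
    linarith
  · simpa using chordEnvelope_le hf.bound hy
  · have h1 : sSup T ≤ (f y - v) / (y - x) := csSup_le hT (hTb y ⟨hyx, hy.2⟩)
    rw [le_div_iff₀ (sub_pos.2 hyx)] at h1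
    linarith

/-- At the endpoints there is no chord on one side, and the pinning bounds `-L` and `L` provide the
supporting slopes instead. -/
lemma exists_support (hf : Pinned f L) {x : ℝ} (hx : x ∈ Icc (0 : ℝ) 1) :
    ∃ z, ∀ y ∈ Icc (0 : ℝ) 1, chordEnvelope f x + z * (y - x) ≤ chordEnvelope f y := by
  rcases eq_or_lt_of_le hx.1 with rfl | h0
  · exact ⟨-L, fun y hy => by simpa [hf.env_zero] using hf.env_lower_left hy⟩
  rcases eq_or_lt_of_le hx.2 with rfl | h1
  · exact ⟨L, fun y hy => by linarith [hf.env_one, hf.env_lower_right hy]⟩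
  obtain ⟨z, hz⟩ := hf.exists_support_Ioo ⟨h0, h1⟩
  refine ⟨z, fun y hy => ?_⟩
  have := le_chordEnvelope (f := f) (m := chordEnvelope f x - z * x) (z := z)
    (fun s hs => by linarith [hz s hs]) hy
  linarith

/-- A function with a supporting line at every point is convex; this avoids having to merge convex
combinations of chords into a single chord. -/
lemma convexOn_env (hf : Pinned f L) : ConvexOn ℝ (Icc 0 1) (chordEnvelope f) := by
  refine ⟨convex_Icc 0 1, fun x hx y hy a b ha hb hab => ?_⟩
  obtain ⟨z, hz⟩ := hf.exists_support (convex_Icc (0 : ℝ) 1 hx hy ha hb hab)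
  simp only [smul_eq_mul] at hz ⊢
  have h1 := mul_le_mul_of_nonneg_left (hz x hx) ha
  have h2 := mul_le_mul_of_nonneg_left (hz y hy) hb
  obtain rfl : b = 1 - a := by linarith
  nlinarith

lemma hasDerivWithinAt_Ioi_env (hf : Pinned f L) {x : ℝ} (hx : x ∈ Ico (0 : ℝ) 1) :
    HasDerivWithinAt (chordEnvelope f) (oneSidedSlope (chordEnvelope f) x) (Ioi x) x := by
  have hxI := Ico_subset_Icc_self hx
  obtain ⟨z, hz⟩ := hf.exists_support hxI
  -- Difference quotients of a convex function are monotone, and the supporting slope bounds them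
  -- from below, so they have a limit.
  have hsub : Ioo x 1 ⊆ {y ∈ Icc (0 : ℝ) 1 | x < y} := fun y hy =>
    ⟨⟨hx.1.trans hy.1.le, hy.2.le⟩, hy.1⟩
  have ht := ((hf.convexOn_env.monotoneOn_slope_gt hxI).mono hsub).tendsto_nhdsWithin_Ioo_right
    (by simpa using hx.2) (by
      refine ⟨z, ?_⟩
      rintro _ ⟨y, hy, rfl⟩
      rw [slope_def_field, le_div_iff₀ (sub_pos.2 hy.1)]
      linarith [hz y (hsub hy).1])
  have : DifferentiableWithinAt ℝ (chordEnvelope f) (Ioi x) x := by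
    refine (hasDerivWithinAt_iff_tendsto_slope
      (f' := sInf (slope (chordEnvelope f) x '' Ioo x 1)) |>.2 ?_).differentiableWithinAt
    simpa using ht
  rw [oneSidedSlope, if_pos hx.2]
  exact this.hasDerivWithinAt

lemma hasDerivWithinAt_Iio_env (hf : Pinned f L) :
    HasDerivWithinAt (chordEnvelope f) (oneSidedSlope (chordEnvelope f) 1) (Iio 1) 1 := by
  have hxI : (1 : ℝ) ∈ Icc (0 : ℝ) 1 := by simp
  obtain ⟨z, hz⟩ := hf.exists_support hxI
  have hsub : Ioo (0 : ℝ) 1 ⊆ {y ∈ Icc (0 : ℝ) 1 | y < 1} := fun y hy =>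
    ⟨⟨hy.1.le, hy.2.le⟩, hy.2⟩
  have ht := ((hf.convexOn_env.monotoneOn_slope_lt hxI).mono hsub).tendsto_nhdsWithin_Ioo_left
    (by simp) (by
      refine ⟨z, ?_⟩
      rintro _ ⟨y, hy, rfl⟩
      rw [slope_comm, slope_def_field, div_le_iff₀ (sub_pos.2 hy.2)]
      linarith [hz y (hsub hy).1])
  have : DifferentiableWithinAt ℝ (chordEnvelope f) (Iio 1) 1 := by
    refine (hasDerivWithinAt_iff_tendsto_slope
      (f' := sSup (slope (chordEnvelope f) 1 '' Ioo 0 1)) |>.2 ?_).differentiableWithinAt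
    simpa using ht
  rw [oneSidedSlope, if_neg (lt_irrefl _)]
  exact this.hasDerivWithinAt

lemma env_subgradient (hf : Pinned f L) {x y : ℝ} (hx : x ∈ Icc (0 : ℝ) 1)
    (hy : y ∈ Icc (0 : ℝ) 1) :
    chordEnvelope f x + oneSidedSlope (chordEnvelope f) x * (y - x) ≤ chordEnvelope f y := by
  have hc := hf.convexOn_env
  rcases lt_or_eq_of_le hx.2 with hx1 | rfl
  · have hd := hf.hasDerivWithinAt_Ioi_env ⟨hx.1, hx1⟩
    rcases lt_trichotomy y x with hyx | rfl | hyx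
    · obtain ⟨z, hz⟩ := hf.exists_support hx
      have hzk : z ≤ oneSidedSlope (chordEnvelope f) x := by
        have ht := hasDerivWithinAt_iff_tendsto_slope.1 hd
        simp only [mem_Ioi, lt_self_iff_false, not_false_eq_true, sdiff_singleton_eq_self] at ht
        refine ge_of_tendsto ht ?_
        filter_upwards [Ioo_mem_nhdsGT hx1] with s hs
        rw [slope_def_field, le_div_iff₀ (sub_pos.2 hs.1)]
        linarith [hz s ⟨hx.1.trans hs.1.le, hs.2.le⟩]
      nlinarith [hz y hy]
    · simp
    · have h1 := hc.le_slope_of_hasDerivWithinAt_Ioi hx hy hyx hd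
      rw [slope_def_field, le_div_iff₀ (sub_pos.2 hyx)] at h1
      linarith
  · rcases eq_or_lt_of_le hy.2 with rfl | hyx
    · simp
    · have h1 := hc.slope_le_of_hasDerivWithinAt_Iio hy hx hyx hf.hasDerivWithinAt_Iio_env
      rw [slope_def_field, div_le_iff₀ (sub_pos.2 hyx)] at h1
      linarith

lemma monotoneOn_slope_env (hf : Pinned f L) :
    MonotoneOn (oneSidedSlope (chordEnvelope f)) (Icc 0 1) := by
  intro x hx y hy hxy
  rcases eq_or_lt_of_le hxy with rfl | hlt
  · rfl
  have h1 := hf.env_subgradient hx hy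
  have h2 := hf.env_subgradient hy hx
  by_contra hcon
  push Not at hcon
  nlinarith

lemma slope_add_linear_env (hf : Pinned f L) (z : ℝ) {x : ℝ} (hx : x ∈ Icc (0 : ℝ) 1) :
    oneSidedSlope (chordEnvelope fun s => z * s + f s) x
      = z + oneSidedSlope (chordEnvelope f) x := by
  have heq : ∀ y ∈ Icc (0 : ℝ) 1,
      chordEnvelope (fun s => z * s + f s) y = z * y + chordEnvelope f y := fun y hy =>
    chordEnvelope_add_linear hf.bound z hy
  have hlin : ∀ s, HasDerivWithinAt (fun y => z * y) z s x := fun s => by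
    simpa using ((hasDerivAt_id x).const_mul z).hasDerivWithinAt
  rcases lt_or_eq_of_le hx.2 with hx1 | rfl
  · have h := (hlin (Ioi x)).add (hf.hasDerivWithinAt_Ioi_env ⟨hx.1, hx1⟩)
    have h' := h.congr_of_eventuallyEq (f₁ := chordEnvelope fun s => z * s + f s) (by
      filter_upwards [Ioo_mem_nhdsGT hx1] with y hy
      exact heq y ⟨hx.1.trans hy.1.le, hy.2.le⟩) (heq x hx)
    rw [oneSidedSlope, if_pos hx1]
    exact h'.derivWithin (uniqueDiffWithinAt_Ioi x)
  · have h := (hlin (Iio 1)).add hf.hasDerivWithinAt_Iio_env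
    have h' := h.congr_of_eventuallyEq (f₁ := chordEnvelope fun s => z * s + f s) (by
      filter_upwards [Ioo_mem_nhdsLT (zero_lt_one (α := ℝ))] with y hy
      exact heq y ⟨hy.1.le, hy.2.le⟩) (heq 1 hx)
    rw [oneSidedSlope, if_neg (lt_irrefl _)]
    exact h'.derivWithin (uniqueDiffWithinAt_Iio 1)

end Pinned

/-! ### Virtual values, the revenue curve and its ironed version -/

namespace Primitives

variable (P : Primitives)

/-- The marginal utility of quality for type `0`. -/
def g' (q : ℝ) : ℝ := derivWithin P.g P.Q q

/-- The virtual value. -/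
def virtualValue (θ : ℝ) : ℝ := θ - (1 - P.F θ) / P.F' θ

/-- The negative of the revenue curve in quantile space. -/
def negRevenue (x : ℝ) : ℝ := -P.quantile x * (1 - x)

/-- The convexified negative revenue curve, as a function of the type. -/
def ironedNegRevenue (θ : ℝ) : ℝ := chordEnvelope P.negRevenue (P.F θ)

/-- The ironed virtual value. -/
def ironedValue (θ : ℝ) : ℝ := oneSidedSlope (chordEnvelope P.negRevenue) (P.F θ)

/-- The ironed surplus of quality `q` for a type with ironed virtual value `v`. -/
def ironedSurplus (v q : ℝ) : ℝ := P.g q + v * q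

lemma J_eq (q θ : ℝ) : P.J q θ = P.g q + P.virtualValue θ * q := by
  simp only [J, u, virtualValue]; ring

lemma zero_mem_Theta : (0 : ℝ) ∈ Theta := ⟨le_rfl, zero_le_one⟩

lemma one_mem_Theta : (1 : ℝ) ∈ Theta := ⟨zero_le_one, le_rfl⟩

lemma uniqueDiffOn_Theta : UniqueDiffOn ℝ Theta := uniqueDiffOn_Icc zero_lt_one

lemma measurableSet_Theta : MeasurableSet Theta := measurableSet_Icc

lemma F_mono : Monotone P.F := ProbabilityTheory.monotone_cdf P.μ

lemma F_nonneg (θ : ℝ) : 0 ≤ P.F θ := ProbabilityTheory.cdf_nonneg P.μ θ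

lemma F_le_one (θ : ℝ) : P.F θ ≤ 1 := ProbabilityTheory.cdf_le_one P.μ θ

lemma F_mem (θ : ℝ) : P.F θ ∈ Icc (0 : ℝ) 1 := ⟨P.F_nonneg θ, P.F_le_one θ⟩

lemma F'_nonneg (θ : ℝ) : 0 ≤ P.F' θ := (P.F_mono.monotoneOn _).derivWithin_nonneg

namespace Assumptions

variable {P}

/-! ### The distribution of types -/

lemma measure_compl_Theta (hP : P.Assumptions) : P.μ Thetaᶜ = 0 := by
  rw [← hP.support_eq]; exact Measure.measure_compl_support

lemma ae_mem_Theta (hP : P.Assumptions) : ∀ᵐ θ ∂P.μ, θ ∈ Theta := by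
  rw [ae_iff]; exact hP.measure_compl_Theta

lemma restrict_Theta (hP : P.Assumptions) : P.μ.restrict Theta = P.μ :=
  Measure.restrict_eq_self_of_ae_mem hP.ae_mem_Theta

lemma F_eq (hP : P.Assumptions) (θ : ℝ) : P.F θ = P.μ.real (Iic θ) := by
  have := hP.prob
  exact ProbabilityTheory.cdf_eq_real P.μ θ

lemma F_zero (hP : P.Assumptions) : P.F 0 = 0 := by
  have h : ∀ x < 0, P.F x = 0 := by
    intro x hx
    rw [hP.F_eq, measureReal_def, measure_mono_null (t := Thetaᶜ) _ hP.measure_compl_Theta]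
    · simp
    · intro y hy hy'
      exact absurd (hy'.1.trans hy) (not_le.2 hx)
  have ht : Tendsto P.F (𝓝[<] 0) (𝓝 (P.F 0)) :=
    (hP.F_continuous.tendsto 0).mono_left nhdsWithin_le_nhds
  refine tendsto_nhds_unique ht (tendsto_const_nhds.congr' ?_)
  filter_upwards [self_mem_nhdsWithin] with x hx
  exact (h x hx).symm

lemma F_one (hP : P.Assumptions) : P.F 1 = 1 := by
  have := hP.prob
  rw [hP.F_eq, measureReal_def, (prob_compl_eq_zero_iff measurableSet_Iic).1]
  · simp
  · refine measure_mono_null (t := Thetaᶜ) ?_ hP.measure_compl_Theta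
    intro y hy hy'
    exact hy hy'.2

lemma hasDerivWithinAt_F (hP : P.Assumptions) {θ : ℝ} (hθ : θ ∈ Theta) :
    HasDerivWithinAt P.F (P.F' θ) Theta θ :=
  ((hP.F_contDiffOn.differentiableOn (by norm_num)) θ hθ).hasDerivWithinAt

lemma continuousOn_F' (hP : P.Assumptions) : ContinuousOn P.F' Theta :=
  hP.F_contDiffOn.continuousOn_derivWithin uniqueDiffOn_Theta (by norm_num)

lemma strictMonoOn_F (hP : P.Assumptions) : StrictMonoOn P.F Theta := by
  refine strictMonoOn_of_deriv_pos (convex_Icc 0 1) hP.F_continuous.continuousOn fun x hx => ?_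
  replace hx : x ∈ Ioo (0 : ℝ) 1 := by simpa [Theta] using hx
  have h := (hP.hasDerivWithinAt_F (Ioo_subset_Icc_self hx)).hasDerivAt (Icc_mem_nhds hx.1 hx.2)
  rw [h.deriv]
  exact hP.F'_pos x (Ioo_subset_Ico_self hx)

lemma image_F (hP : P.Assumptions) {θ : ℝ} (hθ : θ ∈ Theta) : P.F '' Icc 0 θ = Icc 0 (P.F θ) := by
  apply Subset.antisymm
  · rintro _ ⟨t, ht, rfl⟩
    exact ⟨P.F_nonneg t, P.F_mono ht.2⟩
  · have := intermediate_value_Icc hθ.1 hP.F_continuous.continuousOn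
    rwa [hP.F_zero] at this

lemma exists_F_eq (hP : P.Assumptions)
    {x : ℝ} (hx : x ∈ Icc (0 : ℝ) 1) : ∃ θ ∈ Theta, P.F θ = x := by
  have h := hP.image_F one_mem_Theta
  rw [hP.F_one] at h
  rw [← h] at hx
  exact hx

lemma quantile_F (hP : P.Assumptions) {θ : ℝ} (hθ : θ ∈ Theta) : P.quantile (P.F θ) = θ := by
  have : {t ∈ Theta | P.F θ ≤ P.F t} = Icc θ 1 := by
    ext t
    constructor
    · rintro ⟨ht, h⟩
      exact ⟨(hP.strictMonoOn_F.le_iff_le hθ ht).1 h, ht.2⟩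
    · rintro ⟨h1, h2⟩
      exact ⟨⟨hθ.1.trans h1, h2⟩, P.F_mono h1⟩
  rw [quantile, this, csInf_Icc hθ.2]

/-- By the area formula for the monotone map `F`, the integral of `F'` over `[0, b]` is the length
of the image `[0, F b]`; comparing half-lines identifies the measures. -/
lemma withDensity_F' (hP : P.Assumptions) :
    P.μ = (volume.restrict Theta).withDensity fun θ => ENNReal.ofReal (P.F' θ) := by
  have := hP.prob
  refine Measure.ext_of_Iic _ _ fun a => ?_
  rw [withDensity_apply _ measurableSet_Iic, Measure.restrict_restrict measurableSet_Iic]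
  have hμ : P.μ (Iic a) = ENNReal.ofReal (P.F a) := by
    rw [hP.F_eq, ofReal_measureReal]
  rw [hμ]
  rcases lt_or_ge a 0 with ha | ha
  · have h0 : Iic a ∩ Theta = ∅ := by
      ext y
      simp only [mem_inter_iff, mem_Iic, mem_empty_iff_false, iff_false, not_and]
      intro hy hy'
      exact absurd (hy'.1.trans hy) (not_le.2 ha)
    have h1 : P.F a = 0 :=
      le_antisymm (by rw [← hP.F_zero]; exact P.F_mono ha.le) (P.F_nonneg a)
    rw [h0, h1]; simp
  · have h0 : Iic a ∩ Theta = Icc 0 (min a 1) := by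
      ext y
      simp only [Theta, mem_inter_iff, mem_Iic, mem_Icc, le_min_iff]
      tauto
    have hb : min a 1 ∈ Theta := ⟨le_min ha zero_le_one, min_le_right _ _⟩
    have h1 : P.F a = P.F (min a 1) := by
      rcases le_total a 1 with h | h
      · rw [min_eq_left h]
      · rw [min_eq_right h, hP.F_one]
        exact le_antisymm (P.F_le_one a) (by rw [← hP.F_one]; exact P.F_mono h)
    rw [h0, lintegral_deriv_eq_volume_image_of_monotoneOn measurableSet_Icc
      (fun x hx => (hP.hasDerivWithinAt_F ⟨hx.1, hx.2.trans hb.2⟩).mono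
        (Icc_subset_Icc_right hb.2)) (P.F_mono.monotoneOn _), hP.image_F hb, h1]
    simp

lemma aemeasurable_density (hP : P.Assumptions) :
    AEMeasurable (fun θ => ENNReal.ofReal (P.F' θ)) (volume.restrict Theta) :=
  (hP.continuousOn_F'.aemeasurable measurableSet_Theta).ennreal_ofReal

lemma setIntegral_eq (hP : P.Assumptions)
    {s : Set ℝ} (hs : MeasurableSet s) (hsΘ : s ⊆ Theta) (f : ℝ → ℝ) :
    ∫ θ in s, f θ ∂P.μ = ∫ θ in s, f θ * P.F' θ := by
  conv_lhs => rw [hP.withDensity_F']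
  rw [setIntegral_withDensity_eq_setIntegral_toReal_smul₀ hP.aemeasurable_density.restrict
    (Eventually.of_forall fun _ => ENNReal.ofReal_lt_top) _ hs,
    Measure.restrict_restrict_of_subset hsΘ]
  congr 1
  ext θ
  rw [ENNReal.toReal_ofReal (P.F'_nonneg θ), smul_eq_mul, mul_comm]

lemma setIntegral_Icc_eq (hP : P.Assumptions)
    {p q : ℝ} (hp : p ∈ Theta) (hq : q ∈ Theta) (hpq : p ≤ q) (f : ℝ → ℝ) :
    ∫ θ in Icc p q, f θ ∂P.μ = ∫ θ in p..q, f θ * P.F' θ := by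
  rw [hP.setIntegral_eq measurableSet_Icc (Icc_subset_Icc hp.1 hq.2),
    integral_Icc_eq_integral_Ioc, intervalIntegral.integral_of_le hpq]

lemma noAtoms (hP : P.Assumptions) : NullSingletonClass P.μ := by
  rw [hP.withDensity_F']
  infer_instance

/-! ### Virtual values -/

/-- The quotient `(1 - F) / F'` could misbehave at 1, where `F'` may vanish; continuity there is
recovered from the assumed smoothness of `J` at the positive quality `qbar`. -/
lemma continuousOn_virtualValue (hP : P.Assumptions) : ContinuousOn P.virtualValue Theta := by
  have hq := hP.qbar_pos
  have h1 : ContinuousOn (fun θ => P.J P.qbar θ) Theta :=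
    hP.J_contDiffOn.continuousOn.comp (f := fun θ => (P.qbar, θ)) (by fun_prop)
      fun θ hθ => ⟨⟨hq.le, le_rfl⟩, hθ⟩
  have h2 : ContinuousOn (fun θ => (P.J P.qbar θ - P.g P.qbar) / P.qbar) Theta :=
    (h1.sub continuousOn_const).div_const _
  refine h2.congr fun θ _ => ?_
  simp only [P.J_eq]
  field_simp
  ring

lemma virtualValue_mul_F' (hP : P.Assumptions) {θ : ℝ} (hθ : θ ∈ Theta) :
    P.virtualValue θ * P.F' θ = θ * P.F' θ - (1 - P.F θ) := by
  rcases lt_or_eq_of_le hθ.2 with h | rfl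
  · have := (hP.F'_pos θ ⟨hθ.1, h⟩).ne'
    rw [virtualValue]; field_simp
  -- At the top the numerator `1 - F` is zero, so the quotient is 0 even if `F'` vanishes.
  · simp [virtualValue, hP.F_one]

lemma integral_add_virtualValue (hP : P.Assumptions)
    {p q : ℝ} (hp : p ∈ Theta) (hq : q ∈ Theta) (hpq : p ≤ q)
    (z : ℝ) : ∫ θ in p..q, (z + P.virtualValue θ) * P.F' θ
      = (z * P.F q - q * (1 - P.F q)) - (z * P.F p - p * (1 - P.F p)) := by
  have hsub : Icc p q ⊆ Theta := Icc_subset_Icc hp.1 hq.2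
  refine intervalIntegral.integral_eq_sub_of_hasDeriv_right_of_le hpq
    (f := fun θ => z * P.F θ - θ * (1 - P.F θ)) ?_ ?_ ?_
  · have := hP.F_continuous
    fun_prop
  · intro x hx
    have hx' : x ∈ Theta := hsub (Ioo_subset_Icc_self hx)
    have hF : HasDerivAt P.F (P.F' x) x := (hP.hasDerivWithinAt_F hx').hasDerivAt
      (Icc_mem_nhds (hp.1.trans_lt hx.1) (hx.2.trans_le hq.2))
    have h1 := (hF.const_mul z).sub ((hasDerivAt_id x).mul (hF.const_sub 1))
    refine (h1.congr_deriv ?_).hasDerivWithinAt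
    rw [add_mul, hP.virtualValue_mul_F' hx']
    simp; ring
  · refine ContinuousOn.intervalIntegrable ?_
    rw [uIcc_of_le hpq]
    exact ((continuousOn_const.add hP.continuousOn_virtualValue).mul hP.continuousOn_F').mono hsub

/-! ### The quality component of the surplus -/

lemma uniqueDiffOn_Q (hP : P.Assumptions) : UniqueDiffOn ℝ P.Q := uniqueDiffOn_Icc hP.qbar_pos

lemma zero_mem_Q (hP : P.Assumptions) : (0 : ℝ) ∈ P.Q := ⟨le_rfl, hP.qbar_pos.le⟩

lemma hasDerivWithinAt_g (hP : P.Assumptions)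
    {q : ℝ} (hq : q ∈ P.Q) : HasDerivWithinAt P.g (P.g' q) P.Q q :=
  ((hP.g_contDiffOn.differentiableOn (by norm_num)) q hq).hasDerivWithinAt

lemma continuousOn_g' (hP : P.Assumptions) : ContinuousOn P.g' P.Q :=
  hP.g_contDiffOn.continuousOn_derivWithin hP.uniqueDiffOn_Q (by norm_num)

lemma g'_nonneg (hP : P.Assumptions)
    (q : ℝ) : 0 ≤ P.g' q := hP.g_strictMonoOn.monotoneOn.derivWithin_nonneg

lemma g_lt_tangent (hP : P.Assumptions) {x y : ℝ} (hx : x ∈ P.Q) (hy : y ∈ P.Q) (hxy : x ≠ y) :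
    P.g y < P.g x + P.g' x * (y - x) := by
  rcases lt_or_gt_of_ne hxy with h | h
  · have := hP.g_strictConcaveOn.slope_lt_of_hasDerivWithinAt hx hy h (hP.hasDerivWithinAt_g hx)
    rw [slope_def_field, div_lt_iff₀ (sub_pos.2 h)] at this
    linarith
  · have := hP.g_strictConcaveOn.lt_slope_of_hasDerivWithinAt hy hx h (hP.hasDerivWithinAt_g hx)
    rw [slope_def_field, lt_div_iff₀ (sub_pos.2 h)] at this
    linarith

lemma hasDerivWithinAt_ironedSurplus (hP : P.Assumptions) {q : ℝ} (hq : q ∈ P.Q) (v : ℝ) :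
    HasDerivWithinAt (P.ironedSurplus v) (P.g' q + v) P.Q q := by
  have h := (hP.hasDerivWithinAt_g hq).add ((hasDerivWithinAt_id q P.Q).const_mul v)
  rw [mul_one] at h
  exact h

lemma J1_eq (hP : P.Assumptions)
    {q : ℝ} (hq : q ∈ P.Q) (θ : ℝ) : P.J1 q θ = P.g' q + P.virtualValue θ := by
  have h : (fun x => P.J x θ) = P.ironedSurplus (P.virtualValue θ) := funext (P.J_eq · θ)
  rw [J1, h]
  exact (hP.hasDerivWithinAt_ironedSurplus hq _).derivWithin (hP.uniqueDiffOn_Q q hq)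

lemma u1_eq (hP : P.Assumptions) {q : ℝ} (hq : q ∈ P.Q) (θ : ℝ) : P.u1 q θ = P.g' q + θ :=
  (hP.hasDerivWithinAt_ironedSurplus hq θ).derivWithin (hP.uniqueDiffOn_Q q hq)

lemma integral_g' (hP : P.Assumptions)
    {q : ℝ} (hq : q ∈ P.Q) : ∫ x in (0 : ℝ)..q, P.g' x = P.g q - P.g 0 := by
  have hsub : Icc 0 q ⊆ P.Q := Icc_subset_Icc_right hq.2
  refine intervalIntegral.integral_eq_sub_of_hasDeriv_right_of_le hq.1
    (hP.g_contDiffOn.continuousOn.mono hsub) ?_ ?_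
  · intro x hx
    exact ((hP.hasDerivWithinAt_g (hsub (Ioo_subset_Icc_self hx))).hasDerivAt
      (Icc_mem_nhds hx.1 (hx.2.trans_le hq.2))).hasDerivWithinAt
  · refine ContinuousOn.intervalIntegrable ?_
    rw [uIcc_of_le hq.1]
    exact hP.continuousOn_g'.mono hsub

/-! ### Ironing -/

lemma H_F (hP : P.Assumptions) {q θ : ℝ} (hq : q ∈ P.Q) (hθ : θ ∈ Theta) :
    P.H q (P.F θ) = P.g' q * P.F θ - θ * (1 - P.F θ) := by
  rw [H, intervalIntegral.integral_of_le (P.F_nonneg θ), ← integral_Icc_eq_integral_Ioc,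
    ← hP.image_F hθ, integral_image_eq_integral_deriv_smul_of_monotoneOn measurableSet_Icc
      (fun x hx => (hP.hasDerivWithinAt_F ⟨hx.1, hx.2.trans hθ.2⟩).mono
        (Icc_subset_Icc_right hθ.2)) (P.F_mono.monotoneOn _)]
  have h := hP.integral_add_virtualValue zero_mem_Theta hθ hθ.1 (P.g' q)
  rw [intervalIntegral.integral_of_le hθ.1, ← integral_Icc_eq_integral_Ioc, hP.F_zero] at h
  rw [setIntegral_congr_fun (g := fun θ => (P.g' q + P.virtualValue θ) * P.F' θ)
    measurableSet_Icc, h]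
  · ring
  · intro t ht
    simp only [smul_eq_mul]
    rw [hP.quantile_F ⟨ht.1, ht.2.trans hθ.2⟩, hP.J1_eq hq, mul_comm]

lemma negRevenue_F (hP : P.Assumptions)
    {θ : ℝ} (hθ : θ ∈ Theta) : P.negRevenue (P.F θ) = -θ * (1 - P.F θ) := by
  rw [negRevenue, hP.quantile_F hθ]

lemma H_eq (hP : P.Assumptions) {q x : ℝ} (hq : q ∈ P.Q) (hx : x ∈ Icc (0 : ℝ) 1) :
    P.H q x = P.g' q * x + P.negRevenue x := by
  obtain ⟨θ, hθ, rfl⟩ := hP.exists_F_eq hx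
  rw [hP.H_F hq hθ, hP.negRevenue_F hθ]
  ring

lemma exists_pinned (hP : P.Assumptions) : ∃ L, Pinned P.negRevenue L := by
  obtain ⟨L, hL⟩ := (isCompact_Icc (a := (0 : ℝ)) (b := 1)).exists_bound_of_continuousOn
    hP.continuousOn_virtualValue
  -- The bound `L` on the virtual value, which is the slope of the curve in quantile space, controls
  -- the left end; the 1 controls the right end, where `θ ≤ 1` suffices.
  refine ⟨max L 1, ?_, ?_, ?_, ?_⟩
  · simpa [hP.F_zero] using hP.negRevenue_F zero_mem_Theta
  · simpa [hP.F_one] using hP.negRevenue_F one_mem_Theta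
  · intro x hx
    obtain ⟨θ, hθ, rfl⟩ := hP.exists_F_eq hx
    have h := hP.integral_add_virtualValue zero_mem_Theta hθ hθ.1 (max L 1)
    rw [hP.F_zero] at h
    have h2 : 0 ≤ ∫ t in (0 : ℝ)..θ, (max L 1 + P.virtualValue t) * P.F' t := by
      refine intervalIntegral.integral_nonneg hθ.1 fun t ht => ?_
      refine mul_nonneg ?_ (P.F'_nonneg t)
      have := hL t ⟨ht.1, ht.2.trans hθ.2⟩
      rw [Real.norm_eq_abs, abs_le] at this
      linarith [le_max_left L 1]
    rw [hP.negRevenue_F hθ]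
    linarith
  · intro x hx
    obtain ⟨θ, hθ, rfl⟩ := hP.exists_F_eq hx
    rw [hP.negRevenue_F hθ]
    have := le_max_right L 1
    nlinarith [hθ.1, hθ.2, P.F_le_one θ]

/-- Adding a linear function commutes with convexification, so the quality shifts the slope of the
envelope without affecting which types are pooled. -/
lemma slope_F (hP : P.Assumptions) {q θ : ℝ} (hq : q ∈ P.Q) :
    P.slope q (P.F θ) = P.g' q + P.ironedValue θ := by
  obtain ⟨L, hL⟩ := hP.exists_pinned
  have h : P.convH q = chordEnvelope fun s => P.g' q * s + P.negRevenue s := by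
    ext x
    exact chordEnvelope_congr (fun s hs => hP.H_eq hq hs) x
  change oneSidedSlope (P.convH q) (P.F θ) = _
  rw [h, hL.slope_add_linear_env _ (P.F_mem θ)]
  rfl

lemma ironed_subgradient (hP : P.Assumptions) (x y : ℝ) :
    P.ironedNegRevenue x + P.ironedValue x * (P.F y - P.F x) ≤ P.ironedNegRevenue y := by
  obtain ⟨L, hL⟩ := hP.exists_pinned
  exact hL.env_subgradient (P.F_mem x) (P.F_mem y)

lemma monotone_ironedValue (hP : P.Assumptions) : Monotone P.ironedValue := by
  obtain ⟨L, hL⟩ := hP.exists_pinned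
  exact fun x y h => hL.monotoneOn_slope_env (P.F_mem x) (P.F_mem y) (P.F_mono h)

lemma ironedNegRevenue_le (hP : P.Assumptions) {θ : ℝ} (hθ : θ ∈ Theta) :
    P.ironedNegRevenue θ ≤ -θ * (1 - P.F θ) := by
  obtain ⟨L, hL⟩ := hP.exists_pinned
  rw [← hP.negRevenue_F hθ]
  exact chordEnvelope_le hL.bound (P.F_mem θ)

lemma ironedNegRevenue_zero (hP : P.Assumptions) : P.ironedNegRevenue 0 = 0 := by
  obtain ⟨L, hL⟩ := hP.exists_pinned
  rw [ironedNegRevenue, hP.F_zero, hL.env_zero]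

lemma ironedNegRevenue_one (hP : P.Assumptions) : P.ironedNegRevenue 1 = 0 := by
  obtain ⟨L, hL⟩ := hP.exists_pinned
  rw [ironedNegRevenue, hP.F_one, hL.env_one]

lemma le_ironedNegRevenue (hP : P.Assumptions)
    {m z : ℝ} (h : ∀ θ ∈ Theta, m + z * P.F θ ≤ -θ * (1 - P.F θ))
    (θ : ℝ) : m + z * P.F θ ≤ P.ironedNegRevenue θ := by
  refine le_chordEnvelope (fun x hx => ?_) (P.F_mem θ)
  obtain ⟨t, ht, rfl⟩ := hP.exists_F_eq hx
  rw [hP.negRevenue_F ht]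
  exact h t ht

lemma Jbar_eq (hP : P.Assumptions) {q : ℝ} (hq : q ∈ P.Q) (θ : ℝ) :
    P.Jbar q θ = P.ironedSurplus (P.ironedValue θ) q := by
  have h : ∫ x in (0 : ℝ)..q, P.slope x (P.F θ)
      = ∫ x in (0 : ℝ)..q, (P.g' x + P.ironedValue θ) := by
    refine intervalIntegral.integral_congr fun x hx => ?_
    rw [uIcc_of_le hq.1] at hx
    exact hP.slope_F ⟨hx.1, hx.2.trans hq.2⟩
  have hi : IntervalIntegrable P.g' volume 0 q := by
    refine ContinuousOn.intervalIntegrable ?_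
    rw [uIcc_of_le hq.1]
    exact hP.continuousOn_g'.mono (Icc_subset_Icc_right hq.2)
  rw [Jbar, h, intervalIntegral.integral_add hi (by simp), hP.integral_g' hq, P.J_eq,
    intervalIntegral.integral_const, ironedSurplus]
  simp; ring

lemma Jbar1_eq (hP : P.Assumptions) {q : ℝ} (hq : q ∈ P.Q) (θ : ℝ) :
    P.Jbar1 q θ = P.g' q + P.ironedValue θ := by
  refine HasDerivWithinAt.derivWithin ?_ (hP.uniqueDiffOn_Q q hq)
  exact (hP.hasDerivWithinAt_ironedSurplus hq (P.ironedValue θ)).congr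
    (fun x hx => hP.Jbar_eq hx θ) (hP.Jbar_eq hq θ)

lemma ironedSurplus_lt_tangent (hP : P.Assumptions)
    (v : ℝ) {x y : ℝ} (hx : x ∈ P.Q) (hy : y ∈ P.Q) (hxy : x ≠ y) :
    P.ironedSurplus v y < P.ironedSurplus v x + (P.g' x + v) * (y - x) := by
  have := hP.g_lt_tangent hx hy hxy
  simp only [ironedSurplus]
  linarith

lemma ironedSurplus_le_tangent (hP : P.Assumptions)
    (v : ℝ) {x y : ℝ} (hx : x ∈ P.Q) (hy : y ∈ P.Q) :
    P.ironedSurplus v y ≤ P.ironedSurplus v x + (P.g' x + v) * (y - x) := by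
  rcases eq_or_ne x y with rfl | h
  · simp
  · exact (hP.ironedSurplus_lt_tangent v hx hy h).le

lemma continuousOn_ironedSurplus (hP : P.Assumptions)
    (v : ℝ) : ContinuousOn (P.ironedSurplus v) P.Q :=
  hP.g_contDiffOn.continuousOn.add (by fun_prop)

lemma strictConcaveOn_ironedSurplus (hP : P.Assumptions)
    (v : ℝ) : StrictConcaveOn ℝ P.Q (P.ironedSurplus v) := by
  refine hP.g_strictConcaveOn.add_concaveOn ?_
  exact ⟨convex_Icc _ _, fun x _ y _ a b _ _ _ => by simp only [smul_eq_mul]; linarith⟩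

lemma betaBar_spec (hP : P.Assumptions) (θ : ℝ) : P.betaBar θ ∈ P.Q ∧
    ∀ q ∈ P.Q, P.ironedSurplus (P.ironedValue θ) q
      ≤ P.ironedSurplus (P.ironedValue θ) (P.betaBar θ) := by
  set v := P.ironedValue θ
  obtain ⟨b, hb, hmax⟩ := (isCompact_Icc (a := (0 : ℝ)) (b := P.qbar)).exists_isMaxOn
    ⟨0, hP.zero_mem_Q⟩ (hP.continuousOn_ironedSurplus v)
  -- Strict concavity leaves a single maximizer, so the supremum that defines `betaBar` is that
  -- point.
  have hset : P.argmaxQ (fun q => P.Jbar q θ) = {b} := by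
    ext q
    simp only [argmaxQ, mem_ofPred_eq, mem_singleton_iff]
    constructor
    · rintro ⟨hq, h⟩
      refine (hP.strictConcaveOn_ironedSurplus v).eq_of_isMaxOn (fun y hy => ?_) hmax hq hb
      have := h y hy
      rwa [hP.Jbar_eq hq, hP.Jbar_eq hy] at this
    · rintro rfl
      refine ⟨hb, fun y hy => ?_⟩
      rw [hP.Jbar_eq hb, hP.Jbar_eq hy]
      exact hmax hy
  have hβ : P.betaBar θ = b := by rw [betaBar, hset, csSup_singleton]
  rw [hβ]
  exact ⟨hb, fun q hq => hmax hq⟩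

lemma betaBar_mem (hP : P.Assumptions) (θ : ℝ) : P.betaBar θ ∈ P.Q := (hP.betaBar_spec θ).1

lemma ironedSurplus_lt_betaBar (hP : P.Assumptions)
    (θ : ℝ) {q : ℝ} (hq : q ∈ P.Q) (hne : q ≠ P.betaBar θ) :
    P.ironedSurplus (P.ironedValue θ) q
      < P.ironedSurplus (P.ironedValue θ) (P.betaBar θ) := by
  refine lt_of_le_of_ne ((hP.betaBar_spec θ).2 q hq) fun he => hne ?_
  refine (hP.strictConcaveOn_ironedSurplus (P.ironedValue θ)).eq_of_isMaxOn (fun y hy => ?_)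
    (fun y hy => (hP.betaBar_spec θ).2 y hy) hq (hP.betaBar_mem θ)
  simpa [he] using (hP.betaBar_spec θ).2 y hy

lemma betaBar_le_of_ironedValue_le (hP : P.Assumptions)
    {θ θ' : ℝ} (h : P.ironedValue θ ≤ P.ironedValue θ') :
    P.betaBar θ ≤ P.betaBar θ' := by
  by_contra hcon
  push Not at hcon
  have h1 := hP.ironedSurplus_lt_betaBar θ (hP.betaBar_mem θ') hcon.ne
  have h2 := (hP.betaBar_spec θ').2 _ (hP.betaBar_mem θ)
  simp only [ironedSurplus] at h1 h2
  nlinarith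

lemma monotone_betaBar (hP : P.Assumptions) : Monotone P.betaBar := fun _ _ h =>
  hP.betaBar_le_of_ironedValue_le (hP.monotone_ironedValue h)

end Assumptions

end Primitives

/-! ### Integration of a function against the level sets of another one -/

/-- Layer-cake formula for a signed weight `b`: write `a θ` as the length of `{x > 0 | x < a θ}` and
apply Fubini, which is legitimate because `b` is integrable and the levels lie in the bounded
interval `(0, M]`. -/
lemma integral_mul_eq_integral_levels {μ : Measure ℝ} [IsFiniteMeasure μ] {a b : ℝ → ℝ} {M : ℝ}
    (hb : Integrable b μ) (ha : Measurable a) (ha0 : ∀ θ, 0 ≤ a θ) (haM : ∀ θ, a θ ≤ M) :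
    ∫ θ, b θ * a θ ∂μ = ∫ x in Ioc 0 M, ∫ θ in {θ | x < a θ}, b θ ∂μ := by
  have hset : MeasurableSet {p : ℝ × ℝ | p.2 < a p.1} :=
    measurableSet_lt measurable_snd (ha.comp measurable_fst)
  have hint : Integrable (Function.uncurry fun θ x => {p : ℝ × ℝ | p.2 < a p.1}.indicator
      (fun p => b p.1) (θ, x)) (μ.prod (volume.restrict (Ioc 0 M))) :=
    (hb.comp_fst (volume.restrict (Ioc 0 M))).indicator hset
  have hswap := integral_integral_swap hint
  have h1 : ∀ θ, ∫ x in Ioc 0 M, {p : ℝ × ℝ | p.2 < a p.1}.indicator (fun p => b p.1) (θ, x)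
      = b θ * a θ := by
    intro θ
    have e : ∀ x, {p : ℝ × ℝ | p.2 < a p.1}.indicator (fun p => b p.1) (θ, x)
        = (Iio (a θ)).indicator (fun _ => b θ) x := by
      intro x
      simp [indicator_apply]
    simp only [e]
    rw [integral_indicator measurableSet_Iio, Measure.restrict_restrict measurableSet_Iio,
      setIntegral_const]
    have : (Iio (a θ) ∩ Ioc 0 M : Set ℝ) =ᵐ[volume] Ioc 0 (a θ) := by
      refine EventuallyEq.trans ?_ (Ioo_ae_eq_Ioc (a := (0 : ℝ)) (b := a θ))
      refine Eventually.of_forall fun x => propext ?_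
      change (x < a θ ∧ 0 < x ∧ x ≤ M) ↔ (0 < x ∧ x < a θ)
      exact ⟨fun h => ⟨h.2.1, h.1⟩, fun h => ⟨h.2, h.1, h.2.le.trans (haM θ)⟩⟩
    rw [measureReal_congr this]
    simp [ha0 θ, mul_comm]
  have h2 : ∀ x, ∫ θ, {p : ℝ × ℝ | p.2 < a p.1}.indicator (fun p => b p.1) (θ, x) ∂μ
      = ∫ θ in {θ | x < a θ}, b θ ∂μ := by
    intro x
    rw [← integral_indicator (measurableSet_lt measurable_const ha)]
    rfl
  simp only [h1, h2] at hswap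
  exact hswap

/-- The extension to the line of a function on `Θ` that is constant outside of `Θ`. -/
def extendTheta (a : ℝ → ℝ) (θ : ℝ) : ℝ := a (max 0 (min θ 1))

lemma clamp_mem_Theta (θ : ℝ) : max 0 (min θ 1) ∈ Theta :=
  ⟨le_max_left _ _, max_le zero_le_one (min_le_right _ _)⟩

lemma extendTheta_eq {a : ℝ → ℝ} {θ : ℝ} (hθ : θ ∈ Theta) : extendTheta a θ = a θ := by
  rw [extendTheta, min_eq_left hθ.2, max_eq_right hθ.1]

lemma monotone_extendTheta {a : ℝ → ℝ} (ha : MonotoneOn a Theta) : Monotone (extendTheta a) :=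
  fun _ _ h => ha (clamp_mem_Theta _) (clamp_mem_Theta _)
    (max_le_max le_rfl (min_le_min h le_rfl))

/-! ### The gap between the virtual surplus and the ironed virtual surplus -/

namespace Primitives

namespace Assumptions

variable {P : Primitives} (hP : P.Assumptions)

lemma integrable_of_continuousOn (hP : P.Assumptions) {f : ℝ → ℝ} (hf : ContinuousOn f Theta) :
    Integrable f P.μ := by
  have := hP.prob
  rw [← hP.restrict_Theta]
  exact hf.integrableOn_compact isCompact_Icc

lemma integrable_of_monotoneOn (hP : P.Assumptions) {f : ℝ → ℝ} (hf : MonotoneOn f Theta) :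
    Integrable f P.μ := by
  have := hP.prob
  rw [← hP.restrict_Theta]
  exact hf.integrableOn_isCompact isCompact_Icc

lemma integrable_virtualValue (hP : P.Assumptions) : Integrable P.virtualValue P.μ :=
  hP.integrable_of_continuousOn hP.continuousOn_virtualValue

lemma integrable_ironedValue (hP : P.Assumptions) : Integrable P.ironedValue P.μ :=
  hP.integrable_of_monotoneOn (hP.monotone_ironedValue.monotoneOn _)

lemma ae_ne (hP : P.Assumptions) (x : ℝ) : ∀ᵐ θ ∂P.μ, θ ≠ x := by
  have := hP.noAtoms
  rw [ae_iff]
  simp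

/-- Upper sets of types are intervals, up to a null set. -/
lemma upperSet_ae_eq (hP : P.Assumptions) {A : Set ℝ}
    (hA : ∀ s ∈ Theta, ∀ s' ∈ Theta, s ∈ A → s ≤ s' → s' ∈ A) {τ : ℝ}
    (hτ : τ = sInf ({θ ∈ Theta | θ ∈ A} ∪ {1})) :
    τ ∈ Theta ∧ (∀ s ∈ Theta, s < τ → s ∉ A) ∧ (∀ s ∈ Theta, τ < s → s ∈ A) ∧
      A =ᵐ[P.μ] Icc τ 1 := by
  have hne : ({θ ∈ Theta | θ ∈ A} ∪ {1}).Nonempty := ⟨1, Or.inr rfl⟩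
  have hlb : ∀ x ∈ ({θ ∈ Theta | θ ∈ A} ∪ {1}), 0 ≤ x := by
    rintro x (hx | rfl)
    · exact hx.1.1
    · exact zero_le_one
  have hbdd : BddBelow ({θ ∈ Theta | θ ∈ A} ∪ {1}) := ⟨0, hlb⟩
  have h1 : τ ∈ Theta := by
    rw [hτ]
    exact ⟨le_csInf hne hlb, csInf_le hbdd (Or.inr rfl)⟩
  have h2 : ∀ s ∈ Theta, s < τ → s ∉ A := by
    intro s hs hsτ hsA
    rw [hτ] at hsτ
    exact absurd (csInf_le hbdd (Or.inl ⟨hs, hsA⟩)) (not_le.2 hsτ)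
  have h3 : ∀ s ∈ Theta, τ < s → s ∈ A := by
    intro s hs hsτ
    rw [hτ] at hsτ
    obtain ⟨x, hx | rfl, hxs⟩ := exists_lt_of_csInf_lt hne hsτ
    · exact hA x hx.1 s hs hx.2 hxs.le
    · exact absurd hs.2 (not_le.2 hxs)
  refine ⟨h1, h2, h3, ?_⟩
  filter_upwards [hP.ae_mem_Theta, hP.ae_ne τ] with θ hθ hne
  refine propext ⟨fun h => ?_, fun h => ?_⟩
  · exact ⟨not_lt.1 fun hlt => h2 θ hθ hlt h, hθ.2⟩
  · exact h3 θ hθ (lt_of_le_of_ne h.1 (Ne.symm hne))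

lemma integral_Icc_virtualValue (hP : P.Assumptions) {τ : ℝ} (hτ : τ ∈ Theta) (z : ℝ) :
    ∫ θ in Icc τ 1, (z + P.virtualValue θ) ∂P.μ = (z + τ) * (1 - P.F τ) := by
  rw [hP.setIntegral_Icc_eq hτ one_mem_Theta hτ.2,
    hP.integral_add_virtualValue hτ one_mem_Theta hτ.2, hP.F_one]
  ring

lemma integral_Icc_ironedValue (hP : P.Assumptions) {τ : ℝ} (hτ : τ ∈ Theta) :
    ∫ θ in Icc τ 1, P.ironedValue θ ∂P.μ = -P.ironedNegRevenue τ := by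
  have hsub : Icc τ 1 ⊆ Theta := Icc_subset_Icc_left hτ.1
  rw [hP.setIntegral_Icc_eq hτ one_mem_Theta hτ.2,
    integral_of_subgradient hτ.2 (fun x _ y _ => hP.ironed_subgradient x y)
      (hP.monotone_ironedValue.monotoneOn _)
      (fun x hx => (hP.hasDerivWithinAt_F (hsub hx)).mono hsub) (hP.continuousOn_F'.mono hsub),
    hP.ironedNegRevenue_one]
  ring

lemma integral_Icc_gap (hP : P.Assumptions) {τ : ℝ} (hτ : τ ∈ Theta) :
    ∫ θ in Icc τ 1, (P.virtualValue θ - P.ironedValue θ) ∂P.μ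
      = P.ironedNegRevenue τ - -τ * (1 - P.F τ) := by
  have h := hP.integral_Icc_virtualValue hτ 0
  simp only [zero_add] at h
  rw [integral_sub hP.integrable_virtualValue.integrableOn hP.integrable_ironedValue.integrableOn,
    hP.integral_Icc_ironedValue hτ, h]
  ring

lemma continuousOn_ironedNegRevenue (hP : P.Assumptions) : ContinuousOn P.ironedNegRevenue Theta :=
  continuousOn_of_subgradient (fun x _ y _ => hP.ironed_subgradient x y)
    (hP.monotone_ironedValue.monotoneOn _) hP.F_continuous.continuousOn

/-- For a slope `z` strictly between the two ironed values, the lowest line of slope `z` meeting the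
curve is a minorant, hence lies below the envelope; the envelope touches the curve at the contact
point `t`. A contact point outside `[s, s']` would contradict the subgradient inequality at `s` or
`s'`. -/
lemma exists_touching (hP : P.Assumptions) {s s' : ℝ} (hs : s ∈ Theta) (hs' : s' ∈ Theta)
    (hlt : P.ironedValue s < P.ironedValue s') :
    ∃ t ∈ Icc s s', P.ironedNegRevenue t = -t * (1 - P.F t) := by
  obtain ⟨z, hz1, hz2⟩ := exists_between hlt
  have hF := hP.F_continuous
  obtain ⟨t, ht, hmin⟩ := (isCompact_Icc (a := (0 : ℝ)) (b := 1)).exists_isMinOn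
    ⟨0, zero_mem_Theta⟩
    (f := fun θ => -θ * (1 - P.F θ) - z * P.F θ) (by fun_prop)
  have hline : ∀ θ, (-t * (1 - P.F t) - z * P.F t) + z * P.F θ ≤ P.ironedNegRevenue θ :=
    hP.le_ironedNegRevenue fun θ hθ => by
      have : -t * (1 - P.F t) - z * P.F t ≤ -θ * (1 - P.F θ) - z * P.F θ := hmin hθ
      linarith
  have heq : P.ironedNegRevenue t = -t * (1 - P.F t) :=
    le_antisymm (hP.ironedNegRevenue_le ht) (by linarith [hline t])
  refine ⟨t, ⟨?_, ?_⟩, heq⟩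
  · by_contra hcon
    push Not at hcon
    have h1 := hP.ironed_subgradient s t
    have h2 := hline s
    have h3 := hP.strictMonoOn_F ht hs hcon
    nlinarith [mul_pos (sub_pos.2 hz1) (sub_pos.2 h3)]
  · by_contra hcon
    push Not at hcon
    have h1 := hP.ironed_subgradient s' t
    have h2 := hline s'
    have h3 := hP.strictMonoOn_F hs' ht hcon
    nlinarith [mul_pos (sub_pos.2 hz2) (sub_pos.2 h3)]

/-- If curve and envelope differed at `τ`, they would differ on a neighbourhood by continuity, yet
`exists_touching` gives a contact point between any `s < τ < s'`. -/
lemma ironedNegRevenue_eq_of_separated (hP : P.Assumptions) {τ : ℝ} (hτ : τ ∈ Theta)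
    (h : ∀ s ∈ Theta, ∀ s' ∈ Theta, s < τ → τ < s' → P.ironedValue s < P.ironedValue s') :
    P.ironedNegRevenue τ = -τ * (1 - P.F τ) := by
  rcases eq_or_lt_of_le hτ.1 with rfl | h0
  · simp [hP.ironedNegRevenue_zero]
  rcases eq_or_lt_of_le hτ.2 with rfl | h1
  · simp [hP.ironedNegRevenue_one, hP.F_one]
  by_contra hne
  have hF := hP.F_continuous
  have hnhds : Theta ∈ 𝓝 τ := Icc_mem_nhds h0 h1
  have hc : ContinuousAt (fun t => P.ironedNegRevenue t - -t * (1 - P.F t)) τ :=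
    (hP.continuousOn_ironedNegRevenue.continuousAt hnhds).sub (by fun_prop)
  have hev : ∀ᶠ t in 𝓝 τ, P.ironedNegRevenue t - -t * (1 - P.F t) ≠ 0 :=
    hc.eventually_ne (sub_ne_zero.2 hne)
  obtain ⟨l, u, ⟨hl, hu⟩, hsub⟩ := mem_nhds_iff_exists_Ioo_subset.1 (hev.and hnhds)
  obtain ⟨s, hls, hsτ⟩ := exists_between hl
  obtain ⟨s', hτs, hsu⟩ := exists_between hu
  have hs : s ∈ Theta := (hsub ⟨hls, hsτ.trans hu⟩).2
  have hs' : s' ∈ Theta := (hsub ⟨hl.trans hτs, hsu⟩).2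
  obtain ⟨t, ht, hteq⟩ := hP.exists_touching hs hs' (h s hs s' hs' hsτ hτs)
  exact (hsub ⟨hls.trans_le ht.1, ht.2.trans_lt hsu⟩).1 (sub_eq_zero.2 hteq)

lemma integral_gap_mul_eq_levels (hP : P.Assumptions) {a : ℝ → ℝ} {M : ℝ} (ha : MonotoneOn a Theta)
    (haM : MapsTo a Theta (Icc 0 M)) :
    ∫ θ, (P.virtualValue θ - P.ironedValue θ) * a θ ∂P.μ
      = ∫ x in Ioc 0 M, ∫ θ in {θ | x < extendTheta a θ},
        (P.virtualValue θ - P.ironedValue θ) ∂P.μ := by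
  have := hP.prob
  refine Eq.trans (integral_congr_ae ?_) (integral_mul_eq_integral_levels
    (hP.integrable_virtualValue.sub hP.integrable_ironedValue)
    (monotone_extendTheta ha).measurable (fun θ => (haM (clamp_mem_Theta θ)).1)
    (fun θ => (haM (clamp_mem_Theta θ)).2))
  filter_upwards [hP.ae_mem_Theta] with θ hθ
  simp [extendTheta_eq hθ]

lemma level_gap (hP : P.Assumptions) {a : ℝ → ℝ} (ha : MonotoneOn a Theta) (x : ℝ) :
    ∃ τ ∈ Theta, (∀ s ∈ Theta, s < τ → a s ≤ x) ∧ (∀ s ∈ Theta, τ < s → x < a s) ∧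
      ∫ θ in {θ | x < extendTheta a θ}, (P.virtualValue θ - P.ironedValue θ) ∂P.μ
        = P.ironedNegRevenue τ - -τ * (1 - P.F τ) := by
  obtain ⟨h1, h2, h3, h4⟩ := hP.upperSet_ae_eq (A := {θ | x < extendTheta a θ})
    (fun s _ s' _ hs hss => lt_of_lt_of_le (show x < _ from hs) (monotone_extendTheta ha hss)) rfl
  refine ⟨_, h1, fun s hs hsτ => ?_, fun s hs hsτ => ?_, ?_⟩
  · have := h2 s hs hsτ
    rw [mem_ofPred_eq, extendTheta_eq hs] at this
    exact not_lt.1 this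
  · have := h3 s hs hsτ
    rwa [mem_ofPred_eq, extendTheta_eq hs] at this
  · rw [setIntegral_congr_set h4, hP.integral_Icc_gap h1]

/-- Ironing raises the virtual surplus of every nondecreasing allocation. -/
lemma integral_gap_mul_nonpos (hP : P.Assumptions) {a : ℝ → ℝ} {M : ℝ} (ha : MonotoneOn a Theta)
    (haM : MapsTo a Theta (Icc 0 M)) :
    ∫ θ, (P.virtualValue θ - P.ironedValue θ) * a θ ∂P.μ ≤ 0 := by
  rw [hP.integral_gap_mul_eq_levels ha haM]
  refine integral_nonpos fun x => ?_
  obtain ⟨τ, hτ, -, -, h⟩ := hP.level_gap ha x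
  rw [h]
  exact sub_nonpos.2 (hP.ironedNegRevenue_le hτ)

/-- Ironing does not change the virtual surplus of an allocation that is constant where the
ironed virtual value is. -/
lemma integral_gap_mul_eq_zero (hP : P.Assumptions) {a : ℝ → ℝ} {M : ℝ} (ha : MonotoneOn a Theta)
    (haM : MapsTo a Theta (Icc 0 M))
    (hsep : ∀ s ∈ Theta, ∀ s' ∈ Theta, a s < a s' → P.ironedValue s < P.ironedValue s') :
    ∫ θ, (P.virtualValue θ - P.ironedValue θ) * a θ ∂P.μ = 0 := by
  rw [hP.integral_gap_mul_eq_levels ha haM]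
  refine integral_eq_zero_of_ae (Eventually.of_forall fun x => ?_)
  obtain ⟨τ, hτ, h1, h2, h⟩ := hP.level_gap ha x
  rw [hP.ironedNegRevenue_eq_of_separated hτ
    fun s hs s' hs' hsτ hτs => hsep s hs s' hs' ((h1 s hs hsτ).trans_lt (h2 s' hs' hτs)),
    sub_self] at h
  exact h

end Assumptions

end Primitives

lemma measurable_domRestrict_of_monotoneOn {a : ℝ → ℝ} (ha : MonotoneOn a Theta) :
    Measurable (Theta.domRestrict a) :=
  Monotone.measurable fun x y h => ha x.2 y.2 h

/-! ### Information rents and capped allocations -/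

namespace Primitives

variable (P : Primitives)

/-- The information rent of type `θ`. -/
def rent (a t : ℝ → ℝ) (θ : ℝ) : ℝ := P.u (a θ) θ - t θ

/-- The ironed virtual surplus maximizer under the cap `q`. -/
def cappedBeta (q θ : ℝ) : ℝ := min (P.betaBar θ) q

/-- The maximal ironed virtual surplus under the cap `q`. -/
def cappedValue (q : ℝ) : ℝ := ∫ θ, P.ironedSurplus (P.ironedValue θ) (P.cappedBeta q θ) ∂P.μ

namespace IsMechanism

variable {P} {a t : ℝ → ℝ}

lemma rent_subgradient (h : P.IsMechanism a t) :
    ∀ x ∈ Theta, ∀ y ∈ Theta, P.rent a t x + a x * (y - x) ≤ P.rent a t y := by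
  intro x hx y hy
  have := h.2.1 y hy x hx
  simp only [rent, u] at this ⊢
  linarith

lemma monotoneOn (h : P.IsMechanism a t) : MonotoneOn a Theta := by
  intro x hx y hy hxy
  rcases eq_or_lt_of_le hxy with rfl | hlt
  · rfl
  have h1 := h.rent_subgradient x hx y hy
  have h2 := h.rent_subgradient y hy x hx
  by_contra hcon
  push Not at hcon
  nlinarith

end IsMechanism

namespace Assumptions

variable {P}

/-! ### Revenue equivalence -/

/-- Integration by parts: `r (1 - F)` has derivative `a (1 - F) - r F'` wherever `a` is continuous,
and `1 - F = (θ - φ) F'` for the virtual value `φ`. -/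
lemma integral_rent (hP : P.Assumptions) {a r : ℝ → ℝ} (ha : MonotoneOn a Theta)
    (h : ∀ x ∈ Theta, ∀ y ∈ Theta, r x + a x * (y - x) ≤ r y) :
    ∫ θ, r θ ∂P.μ = r 0 + ∫ θ, (θ - P.virtualValue θ) * a θ ∂P.μ := by
  have hF := hP.F_continuous
  have hrc : ContinuousOn r Theta :=
    continuousOn_of_subgradient (f := id) h ha continuousOn_id
  have e1 : ∀ f : ℝ → ℝ, ∫ θ, f θ ∂P.μ = ∫ θ in (0 : ℝ)..1, f θ * P.F' θ := by
    intro f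
    rw [← hP.setIntegral_Icc_eq zero_mem_Theta one_mem_Theta zero_le_one]
    conv_lhs => rw [← hP.restrict_Theta]
    rfl
  have hi1 : IntervalIntegrable (fun θ => a θ * (1 - P.F θ)) volume 0 1 :=
    intervalIntegrable_monotoneOn_mul zero_le_one ha (by fun_prop)
  have hi2 : IntervalIntegrable (fun θ => r θ * P.F' θ) volume 0 1 := by
    refine ContinuousOn.intervalIntegrable ?_
    rw [uIcc_of_le zero_le_one]
    exact hrc.mul hP.continuousOn_F'
  have key : ∫ θ in (0 : ℝ)..1, (a θ * (1 - P.F θ) - r θ * P.F' θ)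
      = r 1 * (1 - P.F 1) - r 0 * (1 - P.F 0) := by
    refine integral_eq_of_hasDerivAt_off_countable_of_le (fun θ => r θ * (1 - P.F θ)) _
      zero_le_one (countable_not_continuousAt_Ioo ha) (hrc.mul (by fun_prop)) ?_ (hi1.sub hi2)
    rintro x ⟨hx, hc⟩
    have hc' : ContinuousAt a x := by
      by_contra hcc
      exact hc ⟨hx, hcc⟩
    have hx' := Ioo_subset_Icc_self hx
    have hnhds := Icc_mem_nhds hx.1 hx.2
    have hr : HasDerivAt r (a x * 1) x :=
      (hasDerivWithinAt_of_subgradient (f := id) h hx' (hasDerivWithinAt_id x _)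
        hc'.continuousWithinAt).hasDerivAt hnhds
    have hFd : HasDerivAt P.F (P.F' x) x := (hP.hasDerivWithinAt_F hx').hasDerivAt hnhds
    refine (hr.mul (hFd.const_sub 1)).congr_deriv ?_
    ring
  rw [intervalIntegral.integral_sub hi1 hi2, hP.F_one, hP.F_zero] at key
  have e2 : ∫ θ in (0 : ℝ)..1, (θ - P.virtualValue θ) * a θ * P.F' θ
      = ∫ θ in (0 : ℝ)..1, a θ * (1 - P.F θ) := by
    refine intervalIntegral.integral_congr fun θ hθ => ?_
    rw [uIcc_of_le zero_le_one] at hθ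
    have := hP.virtualValue_mul_F' hθ
    linear_combination (-(a θ)) * this
  rw [e1, e1, e2]
  linarith

lemma integrable_g_comp (hP : P.Assumptions)
    {a : ℝ → ℝ} (ha : MonotoneOn a Theta) (haQ : MapsTo a Theta P.Q) :
    Integrable (fun θ => P.g (a θ)) P.μ :=
  hP.integrable_of_monotoneOn fun _ hx _ hy hxy =>
    hP.g_strictMonoOn.monotoneOn (haQ hx) (haQ hy) (ha hx hy hxy)

lemma integrable_mul_alloc (hP : P.Assumptions)
    {a v : ℝ → ℝ} (hv : Integrable v P.μ) (ha : MonotoneOn a Theta)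
    (haQ : MapsTo a Theta P.Q) : Integrable (fun θ => v θ * a θ) P.μ := by
  refine hv.mul_bdd (c := P.qbar) (hP.integrable_of_monotoneOn ha).aestronglyMeasurable ?_
  filter_upwards [hP.ae_mem_Theta] with θ hθ
  rw [Real.norm_eq_abs, abs_of_nonneg (haQ hθ).1]
  exact (haQ hθ).2

lemma integrable_id (hP : P.Assumptions) : Integrable (fun θ : ℝ => θ) P.μ :=
  hP.integrable_of_continuousOn continuousOn_id

lemma integrable_surplus (hP : P.Assumptions)
    {a v : ℝ → ℝ} (hv : Integrable v P.μ) (ha : MonotoneOn a Theta)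
    (haQ : MapsTo a Theta P.Q) : Integrable (fun θ => P.ironedSurplus (v θ) (a θ)) P.μ :=
  (hP.integrable_g_comp ha haQ).add (hP.integrable_mul_alloc hv ha haQ)

lemma revenue_eq (hP : P.Assumptions) {a t : ℝ → ℝ} (h : P.IsMechanism a t) :
    P.revenue t = ∫ θ, P.ironedSurplus (P.virtualValue θ) (a θ) ∂P.μ - P.rent a t 0 := by
  have ha := h.monotoneOn
  have haQ := h.1.2
  have hr := hP.integral_rent ha h.rent_subgradient
  have hri : Integrable (P.rent a t) P.μ := hP.integrable_of_continuousOn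
    (continuousOn_of_subgradient (f := id) h.rent_subgradient ha continuousOn_id)
  have hφ : Integrable (fun θ => θ - P.virtualValue θ) P.μ :=
    hP.integrable_id.sub hP.integrable_virtualValue
  have ht : ∀ θ, t θ = P.ironedSurplus θ (a θ) - P.rent a t θ := fun θ => by
    simp [rent, u, ironedSurplus]
  have hs : ∀ θ, P.ironedSurplus (P.virtualValue θ) (a θ)
      = P.ironedSurplus θ (a θ) - (θ - P.virtualValue θ) * a θ := fun θ => by
    simp only [ironedSurplus]; ring
  rw [revenue, hP.restrict_Theta, integral_congr_ae (Eventually.of_forall ht),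
    integral_sub (hP.integrable_surplus hP.integrable_id ha haQ) hri, hr,
    integral_congr_ae (Eventually.of_forall hs),
    integral_sub (hP.integrable_surplus hP.integrable_id ha haQ)
      (hP.integrable_mul_alloc hφ ha haQ)]
  ring

/-- Every nondecreasing allocation is part of a mechanism that leaves no rent to type `0`. -/
lemma exists_mechanism (hP : P.Assumptions)
    {a : ℝ → ℝ} (ha : MonotoneOn a Theta) (haQ : MapsTo a Theta P.Q) :
    ∃ t, P.IsMechanism a t ∧
      P.revenue t = ∫ θ, P.ironedSurplus (P.virtualValue θ) (a θ) ∂P.μ := by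
  -- The envelope formula with zero rent at the bottom; monotonicity of `a` makes it a subgradient
  -- of `r`, which is incentive compatibility.
  set r : ℝ → ℝ := fun θ => ∫ s in (0 : ℝ)..θ, a s with hr
  have hint : ∀ x ∈ Theta, ∀ y ∈ Theta, IntervalIntegrable a volume x y := fun x hx y hy =>
    (ha.mono (uIcc_subset_Icc hx hy)).intervalIntegrable
  have hsub : ∀ x ∈ Theta, ∀ y ∈ Theta, r x + a x * (y - x) ≤ r y := by
    intro x hx y hy
    have hadd := intervalIntegral.integral_add_adjacent_intervals
      (hint 0 zero_mem_Theta x hx) (hint x hx y hy)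
    have : a x * (y - x) ≤ ∫ s in x..y, a s := by
      rcases le_total x y with hxy | hxy
      · have := intervalIntegral.integral_mono_on hxy (by simp) (hint x hx y hy)
          (f := fun _ => a x) fun s hs => ha hx ⟨hx.1.trans hs.1, hs.2.trans hy.2⟩ hs.1
        simpa [mul_comm] using this
      · have := intervalIntegral.integral_mono_on hxy (hint y hy x hx) (by simp)
          (g := fun _ => a x) fun s hs => ha ⟨hy.1.trans hs.1, hs.2.trans hx.2⟩ hx hs.2
        rw [intervalIntegral.integral_symm]
        simp only [intervalIntegral.integral_const, smul_eq_mul] at this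
        linarith
    have e1 : r x = ∫ s in (0 : ℝ)..x, a s := rfl
    have e2 : r y = ∫ s in (0 : ℝ)..y, a s := rfl
    linarith
  have hr0 : r 0 = 0 := by simp [hr]
  have hrnn : ∀ θ ∈ Theta, 0 ≤ r θ := fun θ hθ =>
    intervalIntegral.integral_nonneg hθ.1 fun s hs => (haQ ⟨hs.1, hs.2.trans hθ.2⟩).1
  have hmech : P.IsMechanism a fun θ => P.u (a θ) θ - r θ := by
    refine ⟨⟨measurable_domRestrict_of_monotoneOn ha, haQ⟩, fun θ hθ θ' hθ' => ?_,
      fun θ hθ => ?_⟩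
    · have := hsub θ' hθ' θ hθ
      simp only [u]
      linarith
    · simpa using hrnn θ hθ
  refine ⟨_, hmech, ?_⟩
  rw [hP.revenue_eq hmech]
  simp [rent, hr0]

/-! ### The revenue-maximizing allocation under a cap -/

lemma cappedBeta_mono (hP : P.Assumptions) (q : ℝ) : Monotone (P.cappedBeta q) := fun _ _ h =>
  min_le_min (hP.monotone_betaBar h) le_rfl

lemma cappedBeta_mem (hP : P.Assumptions) {q : ℝ} (hq : q ∈ P.Q) (θ : ℝ) : P.cappedBeta q θ ∈ P.Q :=
  ⟨le_min (hP.betaBar_mem θ).1 hq.1, (min_le_right _ _).trans hq.2⟩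

lemma ironedSurplus_le_capped (hP : P.Assumptions)
    {q x : ℝ} (hq : q ∈ P.Q) (hx : x ∈ P.Q) (hxq : x ≤ q) (θ : ℝ)
    (hne : x ≠ P.cappedBeta q θ) :
    P.ironedSurplus (P.ironedValue θ) x
      < P.ironedSurplus (P.ironedValue θ) (P.cappedBeta q θ) := by
  rw [cappedBeta] at hne ⊢
  rcases le_total (P.betaBar θ) q with h | h
  · rw [min_eq_left h] at hne ⊢
    exact hP.ironedSurplus_lt_betaBar θ hx hne
  · rw [min_eq_right h] at hne ⊢
    have hlt : x < q := lt_of_le_of_ne hxq hne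
    rcases eq_or_lt_of_le h with rfl | hqb
    · exact hP.ironedSurplus_lt_betaBar θ hx hne
    have h1 := hP.ironedSurplus_lt_tangent (P.ironedValue θ) hq hx hne.symm
    have h2 := hP.ironedSurplus_lt_tangent (P.ironedValue θ) hq (hP.betaBar_mem θ) hqb.ne
    have h3 := (hP.betaBar_spec θ).2 q hq
    -- The unconstrained maximizer lies beyond the cap, so by strict concavity the surplus is still
    -- increasing at the cap.
    have h4 : 0 < P.g' q + P.ironedValue θ := by
      by_contra hcon
      push Not at hcon
      nlinarith
    nlinarith

lemma integrable_ironed (hP : P.Assumptions)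
    {a : ℝ → ℝ} (ha : MonotoneOn a Theta) (haQ : MapsTo a Theta P.Q) :
    Integrable (fun θ => P.ironedSurplus (P.ironedValue θ) (a θ)) P.μ :=
  hP.integrable_surplus hP.integrable_ironedValue ha haQ

lemma integrable_capped (hP : P.Assumptions) {q : ℝ} (hq : q ∈ P.Q) :
    Integrable (fun θ => P.ironedSurplus (P.ironedValue θ) (P.cappedBeta q θ)) P.μ :=
  hP.integrable_ironed ((hP.cappedBeta_mono q).monotoneOn _) fun θ _ => hP.cappedBeta_mem hq θ

lemma integral_virtual_eq (hP : P.Assumptions)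
    {a : ℝ → ℝ} (ha : MonotoneOn a Theta) (haQ : MapsTo a Theta P.Q) :
    ∫ θ, P.ironedSurplus (P.virtualValue θ) (a θ) ∂P.μ
      = ∫ θ, P.ironedSurplus (P.ironedValue θ) (a θ) ∂P.μ
        + ∫ θ, (P.virtualValue θ - P.ironedValue θ) * a θ ∂P.μ := by
  refine Eq.trans (integral_congr_ae (Eventually.of_forall fun θ => ?_))
    (integral_add (hP.integrable_ironed ha haQ) (hP.integrable_mul_alloc
      (hP.integrable_virtualValue.sub hP.integrable_ironedValue) ha haQ))
  simp only [ironedSurplus]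
  ring

lemma capped_pointwise (hP : P.Assumptions)
    {a : ℝ → ℝ} {q : ℝ} (hq : q ∈ P.Q) (haQ : MapsTo a Theta P.Q)
    (haq : ∀ θ ∈ Theta, a θ ≤ q) {θ : ℝ} (hθ : θ ∈ Theta) :
    P.ironedSurplus (P.ironedValue θ) (a θ)
      ≤ P.ironedSurplus (P.ironedValue θ) (P.cappedBeta q θ) := by
  by_cases he : a θ = P.cappedBeta q θ
  · rw [he]
  · exact (hP.ironedSurplus_le_capped hq (haQ hθ) (haq θ hθ) θ he).le

lemma integral_ironed_le (hP : P.Assumptions)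
    {a : ℝ → ℝ} {q : ℝ} (hq : q ∈ P.Q) (ha : MonotoneOn a Theta)
    (haQ : MapsTo a Theta P.Q) (haq : ∀ θ ∈ Theta, a θ ≤ q) :
    ∫ θ, P.ironedSurplus (P.ironedValue θ) (a θ) ∂P.μ ≤ P.cappedValue q := by
  refine integral_mono_ae (hP.integrable_ironed ha haQ) (hP.integrable_capped hq) ?_
  filter_upwards [hP.ae_mem_Theta] with θ hθ
  exact hP.capped_pointwise hq haQ haq hθ

lemma revenue_le_ironed (hP : P.Assumptions) {a t : ℝ → ℝ} (h : P.IsMechanism a t) :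
    P.revenue t ≤ ∫ θ, P.ironedSurplus (P.ironedValue θ) (a θ) ∂P.μ := by
  have h0 : 0 ≤ P.rent a t 0 := h.2.2 0 zero_mem_Theta
  have h1 := hP.integral_gap_mul_nonpos h.monotoneOn h.1.2
  rw [hP.revenue_eq h, hP.integral_virtual_eq h.monotoneOn h.1.2]
  linarith

lemma revenue_le_cappedValue (hP : P.Assumptions)
    {a t : ℝ → ℝ} {q : ℝ} (hq : q ∈ P.Q) (h : P.IsMechanism a t)
    (haq : ∀ θ ∈ Theta, a θ ≤ q) : P.revenue t ≤ P.cappedValue q :=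
  (hP.revenue_le_ironed h).trans (hP.integral_ironed_le hq h.monotoneOn h.1.2 haq)

lemma integral_virtual_capped (hP : P.Assumptions) {q : ℝ} (hq : q ∈ P.Q) :
    ∫ θ, P.ironedSurplus (P.virtualValue θ) (P.cappedBeta q θ) ∂P.μ = P.cappedValue q := by
  have ha := (hP.cappedBeta_mono q).monotoneOn Theta
  have haQ : MapsTo (P.cappedBeta q) Theta P.Q := fun θ _ => hP.cappedBeta_mem hq θ
  rw [hP.integral_virtual_eq ha haQ, hP.integral_gap_mul_eq_zero ha haQ, add_zero, cappedValue]
  -- The capped maximizer depends on the type only through the ironed value, monotonically, so it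
  -- can increase only where the ironed value does.
  intro s _ s' _ hlt
  by_contra hcon
  push Not at hcon
  exact absurd (min_le_min (hP.betaBar_le_of_ironedValue_le hcon) le_rfl) (not_le.2 hlt)

/-- Every nondecreasing version of the capped ironed maximizer attains the capped value. -/
lemma exists_mechanism_capped (hP : P.Assumptions)
    {a : ℝ → ℝ} {q : ℝ} (hq : q ∈ P.Q) (ha : MonotoneOn a Theta)
    (haQ : MapsTo a Theta P.Q) (hae : ∀ᵐ θ ∂P.μ, a θ = P.cappedBeta q θ) :
    ∃ t, P.IsMechanism a t ∧ P.revenue t = P.cappedValue q := by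
  obtain ⟨t, ht, hrev⟩ := hP.exists_mechanism ha haQ
  refine ⟨t, ht, ?_⟩
  rw [hrev, ← hP.integral_virtual_capped hq]
  refine integral_congr_ae ?_
  filter_upwards [hae] with θ hθ
  rw [hθ]

lemma ae_eq_capped (hP : P.Assumptions) {a t : ℝ → ℝ} {q : ℝ} (hq : q ∈ P.Q) (h : P.IsMechanism a t)
    (haq : ∀ θ ∈ Theta, a θ ≤ q) (hrev : P.cappedValue q ≤ P.revenue t) :
    ∀ᵐ θ ∂P.μ, a θ = P.cappedBeta q θ := by
  have ha := h.monotoneOn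
  have haQ := h.1.2
  have h1 := hrev.trans (hP.revenue_le_ironed h)
  have h2 := hP.integral_ironed_le hq ha haQ haq
  have hi := (hP.integrable_capped hq).sub (hP.integrable_ironed ha haQ)
  have h0 : ∫ θ, (P.ironedSurplus (P.ironedValue θ) (P.cappedBeta q θ)
      - P.ironedSurplus (P.ironedValue θ) (a θ)) ∂P.μ = 0 := by
    rw [integral_sub (hP.integrable_capped hq) (hP.integrable_ironed ha haQ)]
    exact sub_eq_zero.2 (le_antisymm h1 h2)
  have h3 := (integral_eq_zero_iff_of_nonneg_ae (by
    filter_upwards [hP.ae_mem_Theta] with θ hθ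
    exact sub_nonneg.2 (hP.capped_pointwise hq haQ haq hθ)) hi).1 h0
  filter_upwards [hP.ae_mem_Theta, h3] with θ hθ hθ0
  by_contra hne
  have := hP.ironedSurplus_le_capped hq (haQ hθ) (haq θ hθ) θ hne
  have hθ0' : P.ironedSurplus (P.ironedValue θ) (P.cappedBeta q θ)
      - P.ironedSurplus (P.ironedValue θ) (a θ) = 0 := hθ0
  linarith

lemma V_eq (hP : P.Assumptions) {q : ℝ} (hq : q ∈ P.Q) : P.V q = P.cappedValue q := by
  obtain ⟨t, ht, hrev⟩ := hP.exists_mechanism_capped hq ((hP.cappedBeta_mono q).monotoneOn _)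
    (fun θ _ => hP.cappedBeta_mem hq θ) (Eventually.of_forall fun _ => rfl)
  have hub : ∀ r ∈ {r | ∃ a t, P.IsMechanism a t ∧ (∀ θ ∈ Theta, a θ ≤ q) ∧ r = P.revenue t},
      r ≤ P.cappedValue q := by
    rintro r ⟨a, t, h, haq, rfl⟩
    exact hP.revenue_le_cappedValue hq h haq
  have hmem : P.cappedValue q ∈
      {r | ∃ a t, P.IsMechanism a t ∧ (∀ θ ∈ Theta, a θ ≤ q) ∧ r = P.revenue t} :=
    ⟨_, t, ht, fun θ _ => min_le_right _ _, hrev.symm⟩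
  exact le_antisymm (csSup_le ⟨_, hmem⟩ hub) (le_csSup ⟨_, hub⟩ hmem)

end Assumptions

end Primitives

namespace Primitives

variable (P : Primitives)

/-- The marginal value of relaxing the cap `q`. -/
def marginalValue (q : ℝ) : ℝ := ∫ θ, max (P.g' q + P.ironedValue θ) 0 ∂P.μ

/-- The mean type. -/
def meanType : ℝ := ∫ θ, θ ∂P.μ

namespace Assumptions

variable {P}

/-! ### The revenue function -/

lemma marginal_nonneg_of_lt (hP : P.Assumptions) {q θ : ℝ} (hq : q ∈ P.Q) (h : q < P.betaBar θ) :
    0 ≤ P.g' q + P.ironedValue θ := by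
  have h1 := hP.ironedSurplus_lt_tangent (P.ironedValue θ) hq (hP.betaBar_mem θ) h.ne
  have h2 := (hP.betaBar_spec θ).2 q hq
  by_contra hcon
  push Not at hcon
  nlinarith

lemma marginal_nonpos_of_lt (hP : P.Assumptions) {q θ : ℝ} (hq : q ∈ P.Q) (h : P.betaBar θ < q) :
    P.g' q + P.ironedValue θ ≤ 0 := by
  have h1 := hP.ironedSurplus_lt_tangent (P.ironedValue θ) hq (hP.betaBar_mem θ) h.ne'
  have h2 := (hP.betaBar_spec θ).2 q hq
  by_contra hcon
  push Not at hcon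
  nlinarith

/-- The case `q = betaBar θ` comes from continuity of `g'` as `y` increases to `q`. This needs `q >
0`: at a corner maximizer 0 the marginal surplus may be negative. -/
lemma marginal_nonneg_of_le (hP : P.Assumptions)
    {q θ : ℝ} (hq : q ∈ Ioc 0 P.qbar) (h : q ≤ P.betaBar θ) :
    0 ≤ P.g' q + P.ironedValue θ := by
  have hqQ : q ∈ P.Q := Ioc_subset_Icc_self hq
  have hmem : P.Q ∈ 𝓝[<] q :=
    mem_of_superset (Ioo_mem_nhdsLT hq.1) fun y hy => ⟨hy.1.le, hy.2.le.trans hq.2⟩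
  have ht : Tendsto (fun y => P.g' y + P.ironedValue θ) (𝓝[<] q)
      (𝓝 (P.g' q + P.ironedValue θ)) :=
    ((hP.continuousOn_g' q hqQ).tendsto.mono_left (nhdsWithin_le_of_mem hmem)).add_const _
  refine ge_of_tendsto ht ?_
  filter_upwards [hmem, self_mem_nhdsWithin] with y hy hyq
  exact hP.marginal_nonneg_of_lt hy (lt_of_lt_of_le hyq h)

lemma capped_supergradient (hP : P.Assumptions) {x y : ℝ} (hx : x ∈ P.Q) (hy : y ∈ P.Q) (θ : ℝ) :
    P.ironedSurplus (P.ironedValue θ) (P.cappedBeta y θ)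
      ≤ P.ironedSurplus (P.ironedValue θ) (P.cappedBeta x θ)
        + max (P.g' x + P.ironedValue θ) 0 * (y - x) := by
  have hmQ := hP.cappedBeta_mem hy θ
  have hmy : P.cappedBeta y θ ≤ y := min_le_right _ _
  have hspec := (hP.betaBar_spec θ).2 _ hmQ
  rcases lt_or_ge (P.betaBar θ) x with h | h
  · have e : P.cappedBeta x θ = P.betaBar θ := min_eq_left h.le
    rw [e, max_eq_right (hP.marginal_nonpos_of_lt hx h)]
    linarith
  · have e : P.cappedBeta x θ = x := min_eq_right h
    rw [e]
    rcases le_total 0 (P.g' x + P.ironedValue θ) with h0 | h0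
    · have h1 := hP.ironedSurplus_le_tangent (P.ironedValue θ) hx hmQ
      rw [max_eq_left h0]
      nlinarith
    · rw [max_eq_right h0, zero_mul, add_zero]
      rcases eq_or_lt_of_le h with rfl | hlt
      · exact hspec
      · have h2 := hP.marginal_nonneg_of_lt hx hlt
        have h1 := hP.ironedSurplus_le_tangent (P.ironedValue θ) hx hmQ
        rw [le_antisymm h0 h2] at h1
        linarith

lemma integrable_marginal (hP : P.Assumptions) (q : ℝ) :
    Integrable (fun θ => max (P.g' q + P.ironedValue θ) 0) P.μ :=
  hP.integrable_of_monotoneOn fun _ _ _ _ h =>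
    max_le_max (add_le_add le_rfl (hP.monotone_ironedValue h)) le_rfl

lemma V_supergradient (hP : P.Assumptions) {x y : ℝ} (hx : x ∈ P.Q) (hy : y ∈ P.Q) :
    P.V y ≤ P.V x + P.marginalValue x * (y - x) := by
  rw [hP.V_eq hx, hP.V_eq hy, cappedValue, cappedValue, marginalValue, ← integral_mul_const,
    ← integral_add (hP.integrable_capped hx) ((hP.integrable_marginal x).mul_const _)]
  exact integral_mono (hP.integrable_capped hy)
    ((hP.integrable_capped hx).add ((hP.integrable_marginal x).mul_const _))
    fun θ => hP.capped_supergradient hx hy θ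

lemma continuousOn_marginalValue (hP : P.Assumptions) : ContinuousOn P.marginalValue P.Q := by
  have := hP.prob
  intro x hx
  have hg := ((hP.continuousOn_g' x hx).tendsto.sub_const (P.g' x)).abs
  rw [sub_self, abs_zero] at hg
  refine tendsto_iff_norm_sub_tendsto_zero.2
    (squeeze_zero (fun _ => norm_nonneg _) (fun y => ?_) hg)
  rw [marginalValue, marginalValue,
    ← integral_sub (hP.integrable_marginal y) (hP.integrable_marginal x)]
  refine (norm_integral_le_of_norm_le_const (C := |P.g' y - P.g' x|)
    (Eventually.of_forall fun θ => ?_)).trans (by simp)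
  rw [Real.norm_eq_abs]
  refine (abs_max_sub_max_le_abs _ _ _).trans (le_of_eq ?_)
  congr 1
  ring

lemma hasDerivWithinAt_V (hP : P.Assumptions) {q : ℝ} (hq : q ∈ P.Q) :
    HasDerivWithinAt P.V (P.marginalValue q) P.Q q := by
  have h := hasDerivWithinAt_of_subgradient (S := P.Q) (r := -P.V)
    (a := fun q => -P.marginalValue q) (f := id)
    (fun x hx y hy => by
      have := hP.V_supergradient hx hy
      simp only [id, Pi.neg_apply]
      linarith) hq (hasDerivWithinAt_id q P.Q) (hP.continuousOn_marginalValue q hq).neg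
  simpa using h.neg

lemma concaveOn_V (hP : P.Assumptions) : ConcaveOn ℝ P.Q P.V := by
  refine ⟨convex_Icc _ _, fun x hx y hy a b ha hb hab => ?_⟩
  have hz : a • x + b • y ∈ P.Q := convex_Icc (0 : ℝ) P.qbar hx hy ha hb hab
  have h1 := mul_le_mul_of_nonneg_left (hP.V_supergradient hz hx) ha
  have h2 := mul_le_mul_of_nonneg_left (hP.V_supergradient hz hy) hb
  simp only [smul_eq_mul] at h1 h2 ⊢
  obtain rfl : b = 1 - a := by linarith
  linarith

/-- The marginal ironed surplus is nonnegative on `{q ≤ betaBar θ}` and nonpositive off it, so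
integrating over this set, which is `[T⁻(q), 1]` up to a null set, gives the integral of the
positive part. -/
lemma integral_Tminus (hP : P.Assumptions) {q : ℝ} (hq : q ∈ Ioc 0 P.qbar) :
    ∫ θ in Icc (P.Tminus q) 1, P.Jbar1 q θ ∂P.μ = P.marginalValue q := by
  have hqQ : q ∈ P.Q := Ioc_subset_Icc_self hq
  obtain ⟨-, -, -, h⟩ := hP.upperSet_ae_eq (A := {θ | q ≤ P.betaBar θ}) (τ := P.Tminus q)
    (fun s _ s' _ hs hss => le_trans (show q ≤ _ from hs) (hP.monotone_betaBar hss)) rfl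
  rw [← setIntegral_congr_set h,
    ← integral_indicator (measurableSet_le measurable_const hP.monotone_betaBar.measurable),
    marginalValue]
  refine integral_congr_ae (Eventually.of_forall fun θ => ?_)
  simp only [indicator_apply, mem_ofPred_eq, hP.Jbar1_eq hqQ]
  split_ifs with hθ
  · rw [max_eq_left (hP.marginal_nonneg_of_le hq hθ)]
  · rw [max_eq_right (hP.marginal_nonpos_of_lt hqQ (not_le.1 hθ))]

lemma hasDerivWithinAt_V_Iio (hP : P.Assumptions) {q : ℝ} (hq : q ∈ Ioc 0 P.qbar) :
    HasDerivWithinAt P.V (∫ θ in Icc (P.Tminus q) 1, P.Jbar1 q θ ∂P.μ) (Iio q) q := by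
  rw [hP.integral_Tminus hq]
  exact (hP.hasDerivWithinAt_V (Ioc_subset_Icc_self hq)).mono_of_mem_nhdsWithin
    (mem_of_superset (Ioo_mem_nhdsLT hq.1) fun y hy => ⟨hy.1.le, hy.2.le.trans hq.2⟩)

/-! ### The efficient benchmark -/

lemma integrable_u (hP : P.Assumptions) {a : ℝ → ℝ} (ha : P.IsAllocation a) :
    Integrable (fun θ => P.u (a θ) θ) P.μ := by
  have := hP.prob
  have hg : Measurable (P.Q.domRestrict P.g) :=
    (continuousOn_iff_continuous_domRestrict.1 hP.g_contDiffOn.continuousOn).measurable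
  have hga : Measurable fun θ : Theta => P.g (a θ) :=
    hg.comp (ha.1.subtype_mk (h := fun θ => ha.2 θ.2))
  have hma : AEStronglyMeasurable a P.μ := by
    rw [← hP.restrict_Theta]
    exact (aemeasurable_restrict_of_measurable_subtype measurableSet_Theta
      ha.1).aestronglyMeasurable
  have hmg : AEStronglyMeasurable (fun θ => P.g (a θ)) P.μ := by
    rw [← hP.restrict_Theta]
    exact (aemeasurable_restrict_of_measurable_subtype measurableSet_Theta
      hga).aestronglyMeasurable
  obtain ⟨M, hM⟩ := (isCompact_Icc (a := (0 : ℝ)) (b := P.qbar)).exists_bound_of_continuousOn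
    hP.g_contDiffOn.continuousOn
  refine Integrable.add (Integrable.of_bound hmg M ?_) (hP.integrable_id.mul_bdd
    (c := P.qbar) hma ?_)
  · filter_upwards [hP.ae_mem_Theta] with θ hθ
    exact hM _ (ha.2 hθ)
  · filter_upwards [hP.ae_mem_Theta] with θ hθ
    rw [Real.norm_eq_abs, abs_of_nonneg (ha.2 hθ).1]
    exact (ha.2 hθ).2

lemma integral_u_const (hP : P.Assumptions)
    (q : ℝ) : ∫ θ, P.u q θ ∂P.μ = P.ironedSurplus P.meanType q := by
  have := hP.prob
  simp only [u]
  rw [integral_add (integrable_const _) (hP.integrable_id.mul_const _), integral_mul_const]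
  simp [ironedSurplus, meanType]

/-- Utility increases in quality for every type, so giving everyone the cap is optimal. -/
lemma U_eq (hP : P.Assumptions) {q : ℝ} (hq : q ∈ P.Q) : P.U q = P.ironedSurplus P.meanType q := by
  have hconst : P.IsAllocation fun _ => q := ⟨measurable_const, fun _ _ => hq⟩
  have hub : ∀ r ∈ {r | ∃ a, P.IsAllocation a ∧ (∀ θ ∈ Theta, a θ ≤ q) ∧
      r = ∫ θ in Theta, P.u (a θ) θ ∂P.μ}, r ≤ P.ironedSurplus P.meanType q := by
    rintro r ⟨a, ha, haq, rfl⟩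
    rw [hP.restrict_Theta, ← hP.integral_u_const]
    refine integral_mono_ae (hP.integrable_u ha) (hP.integrable_u hconst) ?_
    filter_upwards [hP.ae_mem_Theta] with θ hθ
    exact add_le_add (hP.g_strictMonoOn.monotoneOn (ha.2 hθ) hq (haq θ hθ))
      (mul_le_mul_of_nonneg_left (haq θ hθ) hθ.1)
  have hmem : P.ironedSurplus P.meanType q ∈ {r | ∃ a, P.IsAllocation a ∧
      (∀ θ ∈ Theta, a θ ≤ q) ∧ r = ∫ θ in Theta, P.u (a θ) θ ∂P.μ} :=
    ⟨_, hconst, fun _ _ => le_rfl, by rw [hP.restrict_Theta, hP.integral_u_const]⟩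
  exact le_antisymm (csSup_le ⟨_, hmem⟩ hub) (le_csSup ⟨_, hub⟩ hmem)

/-- Strict form of Markov's inequality for the type. -/
lemma mul_lt_meanType (hP : P.Assumptions)
    {τ : ℝ} (hτ : τ ∈ Theta) : τ * (1 - P.F τ) < P.meanType := by
  have := hP.prob
  -- The mass of `[τ, 1]` is the difference of `integral_Icc_virtualValue` at `z = 1` and `z = 0`.
  have hone : ∫ _ in Icc τ 1, (1 : ℝ) ∂P.μ = 1 - P.F τ := by
    have h1 := hP.integral_Icc_virtualValue hτ 1
    have h0 := hP.integral_Icc_virtualValue hτ 0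
    simp only [zero_add] at h0
    rw [integral_add (integrable_const _) hP.integrable_virtualValue.integrableOn, h0] at h1
    linarith
  have hind : Integrable ((Icc τ 1).indicator fun _ => τ) P.μ :=
    (integrable_const τ).indicator measurableSet_Icc
  have hint : ∫ θ, (θ - (Icc τ 1).indicator (fun _ => τ) θ) ∂P.μ
      = P.meanType - τ * (1 - P.F τ) := by
    rw [integral_sub hP.integrable_id hind, integral_indicator measurableSet_Icc, ← hone,
      ← integral_const_mul]
    simp [meanType]
  have hnn : 0 ≤ᵐ[P.μ] fun θ => θ - (Icc τ 1).indicator (fun _ => τ) θ := by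
    filter_upwards [hP.ae_mem_Theta] with θ hθ
    simp only [indicator_apply, Pi.zero_apply]
    split_ifs with h
    · exact sub_nonneg.2 h.1
    · simpa using hθ.1
  have h0 := integral_nonneg_of_ae hnn
  rw [hint] at h0
  refine lt_of_le_of_ne (sub_nonneg.1 h0) fun he => ?_
  rw [he, sub_self] at hint
  have hz := (integral_eq_zero_iff_of_nonneg_ae hnn (hP.integrable_id.sub hind)).1 hint
  -- Equality would concentrate the law on `{0, τ}`, which is null because there are no atoms.
  have hF : ∀ᵐ _ ∂P.μ, False := by
    filter_upwards [hz, hP.ae_ne 0, hP.ae_ne τ] with θ h1 h2 h3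
    simp only [indicator_apply, Pi.zero_apply] at h1
    split_ifs at h1
    · exact h3 (by linarith)
    · exact h2 (by linarith)
  simp [ae_iff] at hF

lemma meanType_pos (hP : P.Assumptions) : 0 < P.meanType := by
  simpa using hP.mul_lt_meanType zero_mem_Theta

/-- The seller's marginal revenue is below the marginal surplus. -/
lemma marginalValue_lt (hP : P.Assumptions) (q : ℝ) : P.marginalValue q < P.g' q + P.meanType := by
  have := hP.prob
  have hF := hP.F_continuous
  obtain ⟨t, ht, hmax⟩ := (isCompact_Icc (a := (0 : ℝ)) (b := 1)).exists_isMaxOn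
    ⟨0, zero_mem_Theta⟩ (f := fun θ => θ * (1 - P.F θ)) (by fun_prop)
  -- The horizontal line at minus the maximal posted-price revenue lies below the curve, hence below
  -- its envelope.
  have hC : ∀ τ, -P.meanType < P.ironedNegRevenue τ := by
    intro τ
    have h1 := hP.le_ironedNegRevenue (m := -(t * (1 - P.F t))) (z := 0)
      (fun θ hθ => by
        have : θ * (1 - P.F θ) ≤ t * (1 - P.F t) := hmax hθ
        linarith) τ
    linarith [hP.mul_lt_meanType ht]
  obtain ⟨hτ, -, -, h⟩ := hP.upperSet_ae_eq (A := {θ | 0 ≤ P.g' q + P.ironedValue θ})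
    (fun s _ s' _ hs hss => le_trans (show 0 ≤ P.g' q + P.ironedValue s from hs)
      (add_le_add le_rfl (hP.monotone_ironedValue hss))) rfl
  set τ := sInf ({θ ∈ Theta | θ ∈ {θ | 0 ≤ P.g' q + P.ironedValue θ}} ∪ {1})
  have hw : P.marginalValue q = ∫ θ in Icc τ 1, (P.g' q + P.ironedValue θ) ∂P.μ := by
    rw [← setIntegral_congr_set h, ← integral_indicator (measurableSet_le measurable_const
      (hP.monotone_ironedValue.measurable.const_add _)), marginalValue]
    refine integral_congr_ae (Eventually.of_forall fun θ => ?_)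
    simp only [indicator_apply, mem_ofPred_eq]
    split_ifs with hθ
    · rw [max_eq_left hθ]
    · rw [max_eq_right (not_le.1 hθ).le]
  rw [hw, integral_add (integrable_const _) hP.integrable_ironedValue.integrableOn,
    hP.integral_Icc_ironedValue hτ, setIntegral_const, smul_eq_mul]
  have h1 : P.μ.real (Icc τ 1) ≤ 1 := measureReal_le_one
  have h2 := mul_le_mul_of_nonneg_right h1 (hP.g'_nonneg q)
  linarith [hC τ]

end Assumptions

end Primitives

namespace Primitives

lemma exists_argmaxQ_eq_singleton {P : Primitives} (h0 : 0 ≤ P.qbar) {f : ℝ → ℝ}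
    (hf : StrictConcaveOn ℝ P.Q f) (hc : ContinuousOn f P.Q) : ∃ b, P.argmaxQ f = {b} := by
  obtain ⟨b, hb, hmax⟩ := (isCompact_Icc (a := (0 : ℝ)) (b := P.qbar)).exists_isMaxOn
    ⟨0, le_rfl, h0⟩ hc
  refine ⟨b, Subset.antisymm (fun q hq => ?_) ?_⟩
  · exact hf.eq_of_isMaxOn (fun y hy => hq.2 y hy) hmax hq.1 hb
  · rintro q rfl
    exact ⟨hb, fun y hy => hmax hy⟩

lemma argmaxQ_congr {P : Primitives} {f f' : ℝ → ℝ} (h : ∀ q ∈ P.Q, f q = f' q) :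
    P.argmaxQ f = P.argmaxQ f' := by
  ext q
  constructor
  · rintro ⟨hq, hmax⟩
    exact ⟨hq, fun y hy => by rw [← h q hq, ← h y hy]; exact hmax y hy⟩
  · rintro ⟨hq, hmax⟩
    exact ⟨hq, fun y hy => by rw [h q hq, h y hy]; exact hmax y hy⟩

namespace Assumptions

variable {P : Primitives} (hP : P.Assumptions)

/-! ### The profit-maximizing and the efficient largest quality -/

lemma exists_argmax_profit (hP : P.Assumptions)
    : ∃ b, P.argmaxQ (fun q => P.V q - P.c q) = {b} := by
  refine exists_argmaxQ_eq_singleton hP.qbar_pos.le ?_ ?_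
  · exact hP.concaveOn_V.sub_strictConvexOn hP.c_strictConvexOn
  · exact ContinuousOn.sub (fun q hq => (hP.hasDerivWithinAt_V hq).continuousWithinAt)
      hP.c_differentiableOn.continuousOn

lemma exists_argmax_surplus (hP : P.Assumptions)
    : ∃ b, P.argmaxQ (fun q => P.U q - P.c q) = {b} := by
  rw [argmaxQ_congr (f' := fun q => P.ironedSurplus P.meanType q - P.c q)
    fun q hq => by rw [hP.U_eq hq]]
  refine exists_argmaxQ_eq_singleton hP.qbar_pos.le ?_ ?_
  · exact (hP.strictConcaveOn_ironedSurplus P.meanType).sub hP.c_strictConvexOn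
  · exact (hP.continuousOn_ironedSurplus _).sub hP.c_differentiableOn.continuousOn

lemma hasDerivAt_c (hP : P.Assumptions)
    {q : ℝ} (hq : q ∈ Ioo 0 P.qbar) : HasDerivAt P.c (P.c' q) q :=
  (hP.c_differentiableOn q (Ioo_subset_Icc_self hq)).hasDerivWithinAt.hasDerivAt
    (Icc_mem_nhds hq.1 hq.2)

lemma hasDerivAt_surplus_sub (hP : P.Assumptions) {q : ℝ} (hq : q ∈ Ioo 0 P.qbar) :
    HasDerivAt (fun q => P.ironedSurplus P.meanType q - P.c q)
      (P.g' q + P.meanType - P.c' q) q :=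
  ((hP.hasDerivWithinAt_ironedSurplus (Ioo_subset_Icc_self hq) _).hasDerivAt
    (Icc_mem_nhds hq.1 hq.2)).sub (hP.hasDerivAt_c hq)

lemma hasDerivAt_V (hP : P.Assumptions)
    {q : ℝ} (hq : q ∈ Ioo 0 P.qbar) : HasDerivAt P.V (P.marginalValue q) q :=
  (hP.hasDerivWithinAt_V (Ioo_subset_Icc_self hq)).hasDerivAt (Icc_mem_nhds hq.1 hq.2)

lemma continuousOn_surplus_sub (hP : P.Assumptions) :
    ContinuousOn (fun q => P.ironedSurplus P.meanType q - P.c q) P.Q :=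
  (hP.continuousOn_ironedSurplus _).sub hP.c_differentiableOn.continuousOn

/-- The virtual value has mean zero: its integral over all types is the revenue of the price 0. -/
lemma integral_J1 (hP : P.Assumptions)
    {q : ℝ} (hq : q ∈ P.Q) : ∫ θ in Theta, P.J1 q θ ∂P.μ = P.g' q := by
  have h := hP.integral_Icc_virtualValue zero_mem_Theta (P.g' q)
  rw [hP.F_zero, sub_zero, mul_one, add_zero] at h
  rw [← h]
  exact setIntegral_congr_fun measurableSet_Theta fun θ _ => hP.J1_eq hq θ

lemma integral_u1 (hP : P.Assumptions) {q : ℝ} (hq : q ∈ P.Q) :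
    ∫ θ in Theta, P.u1 q θ ∂P.μ = P.g' q + P.meanType := by
  have := hP.prob
  rw [hP.restrict_Theta]
  simp only [hP.u1_eq hq]
  rw [integral_add (integrable_const _) hP.integrable_id]
  simp [meanType]

/-- It is efficient to produce a positive quality. -/
lemma efficient_ne_zero (hP : P.Assumptions) {b : ℝ}
    (hb : P.argmaxQ (fun q => P.ironedSurplus P.meanType q - P.c q) = {b}) : b ≠ 0 := by
  rintro rfl
  have hmax : (0 : ℝ) ∈ P.argmaxQ (fun q => P.ironedSurplus P.meanType q - P.c q) := by
    rw [hb]; rfl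
  obtain ⟨L, hL, ht⟩ := hP.boundary_zero
  obtain ⟨e, he, hsub⟩ := mem_nhdsGT_iff_exists_Ioo_subset.1 (ht.eventually (lt_mem_nhds hL))
  set e' := min e P.qbar
  have he' : 0 < e' := lt_min he hP.qbar_pos
  have hQ : Icc 0 e' ⊆ P.Q := Icc_subset_Icc_right (min_le_right _ _)
  have hmono : StrictMonoOn (fun q => P.ironedSurplus P.meanType q - P.c q) (Icc 0 e') := by
    refine strictMonoOn_of_deriv_pos (convex_Icc _ _) (hP.continuousOn_surplus_sub.mono hQ)
      fun x hx => ?_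
    rw [interior_Icc] at hx
    have hx' : x ∈ Ioo 0 P.qbar := ⟨hx.1, hx.2.trans_le (min_le_right _ _)⟩
    have hpos : 0 < (∫ θ in Theta, P.J1 x θ ∂P.μ) - P.c' x :=
      hsub ⟨hx.1, hx.2.trans_le (min_le_left _ _)⟩
    rw [hP.integral_J1 (Ioo_subset_Icc_self hx')] at hpos
    rw [(hP.hasDerivAt_surplus_sub hx').deriv]
    -- Near 0 the assumption gives `g' > c'`, and the efficient margin exceeds `g' - c'` by the
    -- positive mean type.
    linarith [hP.meanType_pos]
  have h1 := hmono ⟨le_rfl, he'.le⟩ ⟨he'.le, le_rfl⟩ he'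
  exact absurd (hmax.2 e' (hQ ⟨he'.le, le_rfl⟩)) (not_le.2 h1)

lemma efficient_ne_qbar (hP : P.Assumptions) {b : ℝ}
    (hb : P.argmaxQ (fun q => P.ironedSurplus P.meanType q - P.c q) = {b})
    (hL : ∃ L < 0, Tendsto (fun q => (∫ θ in Theta, P.u1 q θ ∂P.μ) - P.c' q)
      (𝓝[<] P.qbar) (𝓝 L)) : b ≠ P.qbar := by
  rintro rfl
  have hmax : P.qbar ∈ P.argmaxQ (fun q => P.ironedSurplus P.meanType q - P.c q) := by
    rw [hb]; rfl
  obtain ⟨L, hL, ht⟩ := hL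
  obtain ⟨e, he, hsub⟩ := mem_nhdsLT_iff_exists_Ioo_subset.1 (ht.eventually (gt_mem_nhds hL))
  set e' := max e 0
  have he' : e' < P.qbar := max_lt he hP.qbar_pos
  have hQ : Icc e' P.qbar ⊆ P.Q := Icc_subset_Icc_left (le_max_right _ _)
  have hanti : StrictAntiOn (fun q => P.ironedSurplus P.meanType q - P.c q)
      (Icc e' P.qbar) := by
    refine strictAntiOn_of_deriv_neg (convex_Icc _ _) (hP.continuousOn_surplus_sub.mono hQ)
      fun x hx => ?_
    rw [interior_Icc] at hx
    have hx' : x ∈ Ioo 0 P.qbar := ⟨(le_max_right _ _).trans_lt hx.1, hx.2⟩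
    have hneg : (∫ θ in Theta, P.u1 x θ ∂P.μ) - P.c' x < 0 :=
      hsub ⟨(le_max_left _ _).trans_lt hx.1, hx.2⟩
    rw [hP.integral_u1 (Ioo_subset_Icc_self hx')] at hneg
    rw [(hP.hasDerivAt_surplus_sub hx').deriv]
    exact hneg
  have h1 := hanti ⟨le_rfl, he'.le⟩ ⟨he'.le, le_rfl⟩ he'
  exact absurd (hmax.2 e' (hQ ⟨le_rfl, he'.le⟩)) (not_le.2 h1)

lemma strictMonoOn_surplus_sub_V (hP : P.Assumptions) :
    StrictMonoOn (fun q => P.ironedSurplus P.meanType q - P.V q) P.Q := by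
  refine strictMonoOn_of_deriv_pos (convex_Icc _ _) ((hP.continuousOn_ironedSurplus _).sub
    fun q hq => (hP.hasDerivWithinAt_V hq).continuousWithinAt) fun x hx => ?_
  replace hx : x ∈ Ioo 0 P.qbar := by simpa [Q] using hx
  have h := ((hP.hasDerivWithinAt_ironedSurplus (Ioo_subset_Icc_self hx)
    P.meanType).hasDerivAt (Icc_mem_nhds hx.1 hx.2)).sub (hP.hasDerivAt_V hx)
  have h' : deriv (fun q => P.ironedSurplus P.meanType q - P.V q) x = _ := h.deriv
  rw [h']
  linarith [hP.marginalValue_lt x]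

lemma monopoly_lt_efficient (hP : P.Assumptions) {qM qstar : ℝ}
    (hM : P.argmaxQ (fun q => P.V q - P.c q) = {qM})
    (hstar : P.argmaxQ (fun q => P.U q - P.c q) = {qstar})
    (hL : ∃ L < 0, Tendsto (fun q => (∫ θ in Theta, P.u1 q θ ∂P.μ) - P.c' q)
      (𝓝[<] P.qbar) (𝓝 L)) : qM < qstar := by
  rw [argmaxQ_congr (f' := fun q => P.ironedSurplus P.meanType q - P.c q)
    fun q hq => by rw [hP.U_eq hq]] at hstar
  have hMmem : qM ∈ P.argmaxQ (fun q => P.V q - P.c q) := by rw [hM]; rfl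
  have hsmem : qstar ∈ P.argmaxQ (fun q => P.ironedSurplus P.meanType q - P.c q) := by
    rw [hstar]; rfl
  by_contra hcon
  -- A common interior maximizer would equate both marginals to `c'`. If `qM` were larger, the
  -- strict increase of the surplus minus `V` would contradict the two optimality inequalities added
  -- together.
  rcases eq_or_lt_of_le (not_lt.1 hcon) with rfl | hlt
  · have hx : qstar ∈ Ioo 0 P.qbar :=
      ⟨lt_of_le_of_ne hsmem.1.1 (hP.efficient_ne_zero hstar).symm,
        lt_of_le_of_ne hsmem.1.2 (hP.efficient_ne_qbar hstar hL)⟩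
    have hnhds : P.Q ∈ 𝓝 qstar := Icc_mem_nhds hx.1 hx.2
    have h1 : IsLocalMax (fun q => P.V q - P.c q) qstar := by
      filter_upwards [hnhds] with y hy
      exact hMmem.2 y hy
    have h2 : IsLocalMax (fun q => P.ironedSurplus P.meanType q - P.c q) qstar := by
      filter_upwards [hnhds] with y hy
      exact hsmem.2 y hy
    have e1 := h1.hasDerivAt_eq_zero ((hP.hasDerivAt_V hx).sub (hP.hasDerivAt_c hx))
    have e2 := h2.hasDerivAt_eq_zero (hP.hasDerivAt_surplus_sub hx)
    linarith [hP.marginalValue_lt qstar]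
  · have h1 := hP.strictMonoOn_surplus_sub_V hsmem.1 hMmem.1 hlt
    have h2 := hsmem.2 qM hMmem.1
    have h3 := hMmem.2 qstar hsmem.1
    simp only at h1 h2 h3
    linarith

/-! ### Monopolist allocations -/

lemma sSup_image_mem {a : ℝ → ℝ} (ha : MapsTo a Theta P.Q) :
    sSup (a '' Theta) ∈ P.Q ∧ ∀ θ ∈ Theta, a θ ≤ sSup (a '' Theta) := by
  have hbdd : BddAbove (a '' Theta) := ⟨P.qbar, by
    rintro _ ⟨θ, hθ, rfl⟩
    exact (ha hθ).2⟩
  have h1 : ∀ θ ∈ Theta, a θ ≤ sSup (a '' Theta) := fun θ hθ => le_csSup hbdd ⟨θ, hθ, rfl⟩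
  refine ⟨⟨(ha zero_mem_Theta).1.trans (h1 0 zero_mem_Theta), ?_⟩, h1⟩
  refine csSup_le ⟨_, 0, zero_mem_Theta, rfl⟩ ?_
  rintro _ ⟨θ, hθ, rfl⟩
  exact (ha hθ).2

lemma profit_le (hP : P.Assumptions) {a t : ℝ → ℝ} (h : P.IsMechanism a t) :
    P.profit a t ≤ P.V (sSup (a '' Theta)) - P.c (sSup (a '' Theta)) := by
  obtain ⟨h1, h2⟩ := sSup_image_mem h.1.2
  rw [hP.V_eq h1]
  exact sub_le_sub_right (hP.revenue_le_cappedValue h1 h h2) _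

/-- The supremum of the allocation may fall short of the cap, which only lowers the cost. -/
lemma le_profit (hP : P.Assumptions) {a t : ℝ → ℝ} {q : ℝ} (hq : q ∈ P.Q) (h : P.IsMechanism a t)
    (haq : ∀ θ ∈ Theta, a θ ≤ q) (hrev : P.revenue t = P.cappedValue q) :
    P.V q - P.c q ≤ P.profit a t := by
  rw [hP.V_eq hq, profit, hrev]
  have hs : sSup (a '' Theta) ≤ q := csSup_le ⟨_, 0, zero_mem_Theta, rfl⟩ (by
    rintro _ ⟨θ, hθ, rfl⟩
    exact haq θ hθ)
  exact sub_le_sub_left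
    (hP.c_strictMonoOn.monotoneOn (sSup_image_mem h.1.2).1 hq hs) _

lemma isMonopolist_of_capped (hP : P.Assumptions)
    {qM : ℝ} (hM : P.argmaxQ (fun q => P.V q - P.c q) = {qM})
    {a γ : ℝ → ℝ} (hγQ : MapsTo γ Theta P.Q) (hγ : MonotoneOn γ Theta)
    (hae : ∀ᵐ θ ∂P.μ, γ θ = P.betaBar θ) (ha : ∀ θ ∈ Theta, a θ = min (γ θ) qM) :
    P.IsMonopolist a := by
  have hMmem : qM ∈ P.argmaxQ (fun q => P.V q - P.c q) := by rw [hM]; rfl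
  have hmono : MonotoneOn a Theta := fun x hx y hy hxy => by
    rw [ha x hx, ha y hy]
    exact min_le_min (hγ hx hy hxy) le_rfl
  have haM : ∀ θ ∈ Theta, a θ ≤ qM := fun θ hθ => by
    rw [ha θ hθ]
    exact min_le_right _ _
  have haQ : MapsTo a Theta P.Q := fun θ hθ =>
    ⟨by rw [ha θ hθ]; exact le_min (hγQ hθ).1 hMmem.1.1, (haM θ hθ).trans hMmem.1.2⟩
  obtain ⟨t, ht, hrev⟩ := hP.exists_mechanism_capped hMmem.1 hmono haQ (by
    filter_upwards [hP.ae_mem_Theta, hae] with θ hθ h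
    rw [ha θ hθ, h, cappedBeta])
  refine ⟨t, ht, fun a' t' h' => ?_⟩
  exact (hP.profit_le h').trans ((hMmem.2 _ (sSup_image_mem h'.1.2).1).trans
    (hP.le_profit hMmem.1 ht haM hrev))

lemma capped_of_isMonopolist (hP : P.Assumptions)
    {qM : ℝ} (hM : P.argmaxQ (fun q => P.V q - P.c q) = {qM})
    {a : ℝ → ℝ} (ha : P.IsMonopolist a) :
    MonotoneOn a Theta ∧ MapsTo a Theta P.Q ∧ (∀ θ ∈ Theta, a θ ≤ qM) ∧
      ∀ᵐ θ ∂P.μ, a θ = P.cappedBeta qM θ := by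
  have hMmem : qM ∈ P.argmaxQ (fun q => P.V q - P.c q) := by rw [hM]; rfl
  obtain ⟨t, h, hmax⟩ := ha
  obtain ⟨t₀, h₀, hrev₀⟩ := hP.exists_mechanism_capped hMmem.1
    ((hP.cappedBeta_mono qM).monotoneOn _) (fun θ _ => hP.cappedBeta_mem hMmem.1 θ)
    (Eventually.of_forall fun _ => rfl)
  have h1 : P.V qM - P.c qM ≤ P.profit a t :=
    (hP.le_profit hMmem.1 h₀ (fun θ _ => min_le_right _ _) hrev₀).trans (hmax _ _ h₀)
  obtain ⟨hsQ, hs⟩ := sSup_image_mem h.1.2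
  have hsM : sSup (a '' Theta) = qM := by
    have : sSup (a '' Theta) ∈ P.argmaxQ (fun q => P.V q - P.c q) :=
      ⟨hsQ, fun y hy => (hMmem.2 y hy).trans (h1.trans (hP.profit_le h))⟩
    rwa [hM] at this
  rw [hsM] at hs
  refine ⟨h.monotoneOn, h.1.2, hs, hP.ae_eq_capped hMmem.1 h hs ?_⟩
  rw [profit, hsM, hP.V_eq hMmem.1] at h1
  linarith

lemma isMonopolist_iff (hP : P.Assumptions)
    {qM : ℝ} (hM : P.argmaxQ (fun q => P.V q - P.c q) = {qM})
    (a : ℝ → ℝ) : P.IsMonopolist a ↔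
      ∃ γ : ℝ → ℝ, P.IsAllocation γ ∧ MonotoneOn γ Theta ∧
        (∀ᵐ θ ∂P.μ, γ θ = P.betaBar θ) ∧ ∀ θ ∈ Theta, a θ = min (γ θ) qM := by
  have hMmem : qM ∈ P.argmaxQ (fun q => P.V q - P.c q) := by rw [hM]; rfl
  constructor
  · intro h
    obtain ⟨hmono, haQ, haM, hae⟩ := hP.capped_of_isMonopolist hM h
    -- Below the cap `a` already equals `betaBar` almost everywhere and is kept; where `a` reaches
    -- the cap, `betaBar` is restored, raised to at least `qM` so that `min (γ θ) qM = a θ` holds at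
    -- every type and not only almost everywhere.
    set γ : ℝ → ℝ := fun θ => if a θ < qM then a θ else max (P.betaBar θ) qM with hγ
    have hγmono : MonotoneOn γ Theta := by
      intro x hx y hy hxy
      have h1 := hmono hx hy hxy
      have h2 := hP.monotone_betaBar hxy
      simp only [hγ]
      split_ifs with hx' hy' hy'
      · exact h1
      · exact hx'.le.trans (le_max_right _ _)
      · exact absurd (h1.trans_lt hy') hx'
      · exact max_le_max h2 le_rfl
    have hγQ : MapsTo γ Theta P.Q := by
      intro θ hθ
      simp only [hγ]
      split_ifs with h'
      · exact haQ hθ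
      · exact ⟨hMmem.1.1.trans (le_max_right _ _), max_le (hP.betaBar_mem θ).2 hMmem.1.2⟩
    refine ⟨γ, ⟨measurable_domRestrict_of_monotoneOn hγmono, hγQ⟩, hγmono, ?_, ?_⟩
    · filter_upwards [hae] with θ hθ
      rw [cappedBeta] at hθ
      simp only [hγ]
      split_ifs with h'
      · rw [hθ] at h' ⊢
        rcases min_lt_iff.1 h' with h'' | h''
        · exact min_eq_left h''.le
        · exact absurd h'' (lt_irrefl _)
      · rw [hθ, not_lt, le_min_iff] at h'
        exact max_eq_left h'.1
    · intro θ hθ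
      simp only [hγ]
      split_ifs with h'
      · exact (min_eq_left h'.le).symm
      · rw [min_eq_right (le_max_right _ _)]
        exact le_antisymm (haM θ hθ) (not_lt.1 h')
  · rintro ⟨γ, hγ, hγmono, hae, ha⟩
    exact hP.isMonopolist_of_capped hM hγ.2 hγmono hae ha

end Assumptions

end Primitives

end DigitalGoods

end

theorem mainTheorem9 (P : DigitalGoods.Primitives) (hP : P.Assumptions) :
    ConcaveOn ℝ P.Q P.V ∧
    (∀ q ∈ Ioc 0 P.qbar,
      HasDerivWithinAt P.V (∫ θ in Icc (P.Tminus q) 1, P.Jbar1 q θ ∂P.μ) (Iio q) q) ∧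
    ∃ qM qstar : ℝ,
      P.argmaxQ (fun q => P.V q - P.c q) = {qM} ∧
      P.argmaxQ (fun q => P.U q - P.c q) = {qstar} ∧
      (∀ a : ℝ → ℝ, P.IsMonopolist a ↔
        ∃ γ : ℝ → ℝ, P.IsAllocation γ ∧ MonotoneOn γ DigitalGoods.Theta ∧
          (∀ᵐ θ ∂P.μ, γ θ = P.betaBar θ) ∧
          ∀ θ ∈ DigitalGoods.Theta, a θ = min (γ θ) qM) ∧
      ((∃ L < 0, Tendsto (fun q => (∫ θ in DigitalGoods.Theta, P.u1 q θ ∂P.μ) - P.c' q)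
          (𝓝[<] P.qbar) (𝓝 L)) →
        qM < qstar) := by
  obtain ⟨qM, hM⟩ := hP.exists_argmax_profit
  obtain ⟨qstar, hstar⟩ := hP.exists_argmax_surplus
  exact ⟨hP.concaveOn_V, fun q hq => hP.hasDerivWithinAt_V_Iio hq, qM, qstar, hM, hstar,
    hP.isMonopolist_iff hM, hP.monopoly_lt_efficient hM hstar⟩
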